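/- Let $d\ge 2$ and let $C=\{c_1,\dots,c_n\}\subset\mathbb E^d$ be the vertex set of a $d$-dimensional convex polytope $\mathbf C=\mathrm{conv}(C)$ (so $n\ge d+1\ge 3$). For $x\in\mathbb E^d$ let $R_f(x)=\{c\in C:\ \|x-c\|\ge\|x-c'\|\text{ for all }c'\in C\}$, and for $S\subseteq C$ put $V_S=R_f^{-1}(S)$. The farthest-point Voronoi diagram $V_f(C)$ is the partition of $\mathbb E^d$ into the nonempty sets $V_S$, called its faces; the dimension of a nonempty set is that of its affine hull, and the $0$-dimensional faces are the vertices of $V_f(C)$. Let $D_f(C)=\{\mathrm{conv}(S): S\subseteq C,\ V_S\ne\emptyset\}$ be the farthest-point Delaunay complex and let $\partial D_f(C)=\{Q\in D_f(C): Q\subset\mathrm{bd}(\mathbf C)\}$ be the boundary Delaunay complex. For $r>0$ let $\mathbf P_{C,r}=\bigcap_{c\in C}\mathbf B^d[c,r]$, where $\mathbf B^d[c,r]$ is the closed ball of radius $r$ centered at $c$. It is called a basic $r$-ball polyhedron if $C$ is contained in some open ball of radius $r$, for every $c\in C$ some closed ball of radius $r$ contains $C\setminus\{c\}$ but not $c$,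 and every vertex of $V_f(C)$ lies in $\mathrm{int}(\mathbf P_{C,r})$. For $1\le k\le d$, a $(k-1)$-dimensional face (resp. closed $(k-1)$-dimensional face) of $\mathbf P_{C,r}$ is a set $V_S\cap\mathrm{bd}(\mathbf P_{C,r})$ (resp. $\mathrm{cl}(V_S)\cap\mathrm{bd}(\mathbf P_{C,r})$), where $V_S$ is a $k$-dimensional face of $V_f(C)$ with $V_S\cap\mathrm{bd}(\mathbf P_{C,r})\neq\emptyset$. $\mathbf P_{C,r}$ is called a standard $r$-ball polyhedron if it has nonempty interior, omitting any one of the balls $\mathbf B^d[c,r]$, $c\in C$, gives a strictly larger intersection, and, whenever a sphere $\Sigma$ (of any dimension $0\le l\le d-1$ and any radius $s\ge 0$) is the intersection of one or more of the spheres $\mathrm{bd}(\mathbf B^d[c,r])$, $c\in C$, and meets $\mathbf P_{C,r}$, the set $\Sigma\cap\mathbf P_{C,r}$ is homeomorphic to a closed Euclidean ball of some dimension. Then: (i) For every $S\subseteq C$ and $0\le k\le d$: $V_S$ is a $k$-dimensional face of $V_f(C)$ if and only if $\mathrm{conv}(S)\in D_f(C)$ and $\dim\mathrm{conv}(S)=d-k$.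 (ii) For every $r>0$ such that $\mathbf P_{C,r}$ is a basic $r$-ball polyhedron, every $S\subseteq C$ and $1\le k\le d$: $V_S\cap\mathrm{bd}(\mathbf P_{C,r})$ is a $(k-1)$-dimensional face of $\mathbf P_{C,r}$ if and only if $\mathrm{conv}(S)\in\partial D_f(C)$ and $\dim\mathrm{conv}(S)=d-k$. (iii) There is $r_0>0$, depending only on $C$, such that for all $r\ge r_0$ the set $\mathbf P_{C,r}$ is a basic $r$-ball polyhedron and also a standard $r$-ball polyhedron, and for $1\le k\le d$ every $(k-1)$-dimensional face of $\mathbf P_{C,r}$ is homeomorphic to an open ball of dimension $k-1$ and every closed $(k-1)$-dimensional face of $\mathbf P_{C,r}$ is homeomorphic to a closed ball of dimension $k-1$. -/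

import Mathlib

namespace BallPoly

/-- The `d`-dimensional Euclidean space. -/
abbrev E (d : ℕ) : Type := EuclideanSpace ℝ (Fin d)

variable {d : ℕ}

/-- The (affine) dimension of a set: the dimension of its affine hull.
It is only ever used for nonempty sets. -/
noncomputable def setDim (X : Set (E d)) : ℕ :=
  Module.finrank ℝ (vectorSpan ℝ X)

/-- `C` is the vertex set of a `d`-dimensional convex polytope in `E d`. -/
structure IsPolytopeVertexSet (C : Set (E d)) : Prop where
  finite : C.Finite
  vertices : (convexHull ℝ C).extremePoints ℝ = C
  full_dim : affineSpan ℝ (convexHull ℝ C) = ⊤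

/-- `R_f(x)`: the points of `C` that are farthest from `x`. -/
def farthestPoints (C : Set (E d)) (x : E d) : Set (E d) :=
  {c | c ∈ C ∧ ∀ c' ∈ C, dist x c' ≤ dist x c}

/-- `V_S = R_f⁻¹(S)`. -/
def cell (C S : Set (E d)) : Set (E d) :=
  farthestPoints C ⁻¹' {S}

/-- The farthest-point Voronoi diagram `V_f(C)`: the partition of the space into the equivalence
classes of the relation `R_f(x) = R_f(y)`. Its members are the faces of the diagram. -/
def voronoiDiagram (C : Set (E d)) : Set (Set (E d)) :=
  (Setoid.ker (farthestPoints C)).classes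

/-- `V` is a `k`-dimensional face of the farthest-point Voronoi diagram of `C`. -/
def IsVoronoiFace (C : Set (E d)) (k : ℕ) (V : Set (E d)) : Prop :=
  V ∈ voronoiDiagram C ∧ setDim V = k

/-- The farthest-point Delaunay complex `D_f(C)`. -/
def delaunayComplex (C : Set (E d)) : Set (Set (E d)) :=
  {Q | ∃ S, S ⊆ C ∧ (cell C S).Nonempty ∧ Q = convexHull ℝ S}

/-- The farthest-point boundary Delaunay complex `∂D_f(C)`. -/
def boundaryDelaunayComplex (C : Set (E d)) : Set (Set (E d)) :=
  {Q | Q ∈ delaunayComplex C ∧ Q ⊆ frontier (convexHull ℝ C)}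

/-- `P_{C,r}`: the intersection of the closed balls of radius `r` centered at the points of `C`. -/
def ballPolyhedron (C : Set (E d)) (r : ℝ) : Set (E d) :=
  ⋂ c ∈ C, Metric.closedBall c r

/-- The `r`-convex hull: the intersection of all closed balls of radius `r` containing `X`. -/
def rConvexHull (r : ℝ) (X : Set (E d)) : Set (E d) :=
  ⋂ (x : E d) (_ : X ⊆ Metric.closedBall x r), Metric.closedBall x r

/-- The points of `C` lie in `r`-convex position. -/
def InRConvexPosition (C : Set (E d)) (r : ℝ) : Prop :=
  (∃ p : E d, C ⊆ Metric.ball p r) ∧ ∀ c ∈ C, c ∉ rConvexHull r (C \ {c})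

/-- `P_{C,r}` is a basic `r`-ball polyhedron with center-polytope `conv C`. -/
structure IsBasic (C : Set (E d)) (r : ℝ) : Prop where
  polytope : IsPolytopeVertexSet C
  pos : 0 < r
  rConvex : InRConvexPosition C r
  vertices_mem : ∀ V, IsVoronoiFace C 0 V → V ⊆ interior (ballPolyhedron C r)

/-- `F` is an `m`-dimensional face of `P_{C,r}`: a nonempty intersection of an
`(m + 1)`-dimensional Voronoi face with the boundary of `P_{C,r}`. -/
def IsFace (C : Set (E d)) (r : ℝ) (m : ℕ) (F : Set (E d)) : Prop :=
  ∃ V, IsVoronoiFace C (m + 1) V ∧ (V ∩ frontier (ballPolyhedron C r)).Nonempty ∧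
    F = V ∩ frontier (ballPolyhedron C r)

/-- `F` is a closed `m`-dimensional face of `P_{C,r}`. -/
def IsClosedFace (C : Set (E d)) (r : ℝ) (m : ℕ) (F : Set (E d)) : Prop :=
  ∃ V, IsVoronoiFace C (m + 1) V ∧ (V ∩ frontier (ballPolyhedron C r)).Nonempty ∧
    F = closure V ∩ frontier (ballPolyhedron C r)

/-- `P_{C,r}` is an `r`-ball polyhedron (nonempty interior, finitely many balls) for which the balls
centered at the points of `C` form a reduced generating family. -/
structure IsReducedBallPolyhedron (C : Set (E d)) (r : ℝ) : Prop where
  pos : 0 < r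
  finite : C.Finite
  nontrivial : C.Nontrivial
  interior_nonempty : (interior (ballPolyhedron C r)).Nonempty
  reduced : ∀ c ∈ C, ballPolyhedron C r ≠ ballPolyhedron (C \ {c}) r

/-- `Sph` is the `l`-dimensional sphere `S^l(p, s)` (lying in some `(l + 1)`-dimensional affine
subspace through `p`). A sphere of radius `0` is the point `p`. -/
def IsSphere (l : ℕ) (p : E d) (s : ℝ) (Sph : Set (E d)) : Prop :=
  0 ≤ s ∧ ∃ A : AffineSubspace ℝ (E d), p ∈ A ∧ Module.finrank ℝ A.direction = l + 1 ∧
    Sph = {x | x ∈ A ∧ dist x p = s}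

/-- `Sph` is a supporting sphere of `P_{C,r}`: a sphere of some dimension that is an intersection of
some generating spheres and meets `P_{C,r}`. -/
def IsSupportingSphere (C : Set (E d)) (r : ℝ) (Sph : Set (E d)) : Prop :=
  (∃ (l : ℕ) (p : E d) (s : ℝ), IsSphere l p s Sph) ∧
  (∃ T : Set (E d), T ⊆ C ∧ T.Nonempty ∧ Sph = ⋂ c ∈ T, Metric.sphere c r) ∧
  (Sph ∩ ballPolyhedron C r).Nonempty

/-- `F` is homeomorphic to a closed Euclidean ball of dimension `m`. -/
def IsClosedTopBall (m : ℕ) (F : Set (E d)) : Prop :=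
  Nonempty (F ≃ₜ Metric.closedBall (0 : E m) 1)

/-- `F` is homeomorphic to an open Euclidean ball of dimension `m`. -/
def IsOpenTopBall (m : ℕ) (F : Set (E d)) : Prop :=
  Nonempty (F ≃ₜ Metric.ball (0 : E m) 1)

/-- `P_{C,r}` is a standard `r`-ball polyhedron. -/
def IsStandard (C : Set (E d)) (r : ℝ) : Prop :=
  IsReducedBallPolyhedron C r ∧
  ∀ Sph : Set (E d), IsSupportingSphere C r Sph →
    ∃ m : ℕ, IsClosedTopBall m (Sph ∩ ballPolyhedron C r)

end BallPoly

/-! Fix `s ∈ S`. The comparison of the distances from `x` to `s` and to `c` is the sign of a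
function affine in `x` (`gap`), so a nonempty `V_S` is a relatively open convex polyhedron:
equalities for `c ∈ S`, strict inequalities for the other `c`. Its directions form the orthogonal
complement of the directions of `S`. This duality gives (i), since `conv S` determines `S` for
vertices of a polytope.

On the closed cell `s` is a farthest point, so there the boundary of `P_{C,r}` is the sphere of
radius `r` about `s`. If `conv S` meets the interior of `conv C`, the closed cell is bounded, the
distance to `s` is maximal at a Voronoi vertex, and the cell misses the boundary of a basic ball
polyhedron. If `conv S` lies in the boundary of `conv C`, a supporting hyperplane gives a direction
in which the cell recedes, and a ray leaves `P_{C,r}` inside the cell. This is (ii):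
`cell_inter_frontier_nonempty_iff`.

For (iii), finitely many conditions must hold for large `r`. The topological one rests on a unit
recession direction `u` that makes acute angles with all nonzero recession directions
(`exists_pole`). For large `r` the part of the closed cell on the sphere lies in the open hemisphere
around `u` (`eventually_inner_pos`), so projection along `u` is injective on it. As the cell recedes
along `u`, the image is bounded and convex, hence a topological ball. The sections by supporting
spheres are closed faces (`exists_cellHull_eq`), so standardness follows as well. -/

/-! ### Convex sets that cut topological balls out of spheres -/

section SphericalGraph

variable {L : Type*} [NormedAddCommGroup L] [InnerProductSpace ℝ L]

open Metric Set Filter Topology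

namespace BallPoly

lemma coe_orthogonalProjection_orthogonal_unit {u : L} (hu : ‖u‖ = 1) (x : L) :
    (((ℝ ∙ u)ᗮ.orthogonalProjectionOnto x : (ℝ ∙ u)ᗮ) : L) = x - inner ℝ u x • u := by
  have h := Submodule.starProjection_orthogonal_val (K := ℝ ∙ u) x
  rw [Submodule.starProjection_unit_singleton ℝ hu] at h
  rw [Submodule.coe_orthogonalProjectionOnto_apply]
  exact h

lemma norm_sq_orthogonalProjection_orthogonal_unit {u : L} (hu : ‖u‖ = 1) (x : L) :
    ‖(ℝ ∙ u)ᗮ.orthogonalProjectionOnto x‖ ^ 2 = ‖x‖ ^ 2 - inner ℝ u x ^ 2 := by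
  rw [← Submodule.norm_coe, coe_orthogonalProjection_orthogonal_unit hu, norm_sub_sq_real,
    norm_smul, hu, inner_smul_right, real_inner_comm, Real.norm_eq_abs, mul_one, sq_abs]
  ring

lemma norm_sq_add_smul_unit {u : L} (hu : ‖u‖ = 1) (x : L) (t : ℝ) :
    ‖x + t • u‖ ^ 2 = ‖x‖ ^ 2 + 2 * t * inner ℝ u x + t ^ 2 := by
  rw [norm_add_sq_real, norm_smul, hu, inner_smul_right, real_inner_comm, Real.norm_eq_abs,
    mul_one, sq_abs]
  ring

lemma orthogonalProjection_add_smul {u : L} (x : L) (t : ℝ) :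
    (ℝ ∙ u)ᗮ.orthogonalProjectionOnto (x + t • u) = (ℝ ∙ u)ᗮ.orthogonalProjectionOnto x := by
  rw [map_add, map_smul, Submodule.orthogonalProjectionOnto_orthogonalComplement_singleton_eq_zero,
    smul_zero, add_zero]

/-- A subset of an open hemisphere is homeomorphic to its orthogonal projection to the equatorial
hyperplane. -/
lemma nonempty_homeomorph_projection_of_hemisphere {u : L} (hu : ‖u‖ = 1) {R : ℝ} {F : Set L}
    (hF : ∀ x ∈ F, ‖x‖ = R) (hpos : ∀ x ∈ F, 0 < inner ℝ u x) :
    Nonempty (F ≃ₜ (ℝ ∙ u)ᗮ.orthogonalProjectionOnto '' F) := by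
  have key : ∀ x ∈ F, (((ℝ ∙ u)ᗮ.orthogonalProjectionOnto x : (ℝ ∙ u)ᗮ) : L) +
      √(R ^ 2 - ‖(ℝ ∙ u)ᗮ.orthogonalProjectionOnto x‖ ^ 2) • u = x := by
    intro x hx
    rw [norm_sq_orthogonalProjection_orthogonal_unit hu, hF x hx,
      coe_orthogonalProjection_orthogonal_unit hu, sub_sub_cancel, Real.sqrt_sq (hpos x hx).le]
    abel
  have hmem : ∀ y : (ℝ ∙ u)ᗮ.orthogonalProjectionOnto '' F,
      (y.1 : L) + √(R ^ 2 - ‖y.1‖ ^ 2) • u ∈ F := by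
    rintro ⟨_, x, hx, rfl⟩
    exact (key x hx).symm ▸ hx
  exact ⟨{  toFun := fun x => ⟨_, mem_image_of_mem _ x.2⟩
            invFun := fun y => ⟨(y.1 : L) + √(R ^ 2 - ‖y.1‖ ^ 2) • u, hmem y⟩
            left_inv := fun x => Subtype.ext (key x x.2)
            right_inv := by
              rintro ⟨_, x, hx, rfl⟩
              exact Subtype.ext (congrArg (ℝ ∙ u)ᗮ.orthogonalProjectionOnto (key x hx))
            continuous_toFun := by fun_prop
            continuous_invFun := Continuous.subtype_mk (by fun_prop) _ }⟩

/-- Sliding a point of the upper half-ball along `u` up to the sphere stays in `G` and keeps the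
projection. The point of the description on the right is that it is visibly convex, unlike a piece
of the sphere. -/
lemma projection_inter_sphere_eq {u : L} (hu : ‖u‖ = 1) {R : ℝ} (hR : 0 < R) {G : Set L}
    (hrec : ∀ x ∈ G, ∀ t : ℝ, 0 ≤ t → x + t • u ∈ G)
    (hpos : ∀ x ∈ G, ‖x‖ = R → 0 < inner ℝ u x) :
    (ℝ ∙ u)ᗮ.orthogonalProjectionOnto '' (G ∩ sphere 0 R) =
      (ℝ ∙ u)ᗮ.orthogonalProjectionOnto '' (G ∩ closedBall 0 R ∩ {x | 0 ≤ inner ℝ u x}) := by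
  apply Subset.antisymm
  · apply image_mono
    rintro x ⟨hx, hxR⟩
    exact ⟨⟨hx, sphere_subset_closedBall hxR⟩, (hpos x hx (by simpa using hxR)).le⟩
  · rintro _ ⟨x, ⟨⟨hx, hxR⟩, hx0⟩, rfl⟩
    rw [mem_closedBall_zero_iff] at hxR
    rw [mem_ofPred_eq] at hx0
    have h1 : ‖x‖ ^ 2 ≤ R ^ 2 := by gcongr
    set i := inner ℝ u x
    have h2 : i ≤ √(R ^ 2 - ‖x‖ ^ 2 + i ^ 2) := Real.le_sqrt_of_sq_le (by linarith)
    -- The square root is the height of the sphere above the projection of `x`, whose squared norm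
    -- is `‖x‖ ^ 2 - i ^ 2`.
    refine ⟨x + (√(R ^ 2 - ‖x‖ ^ 2 + i ^ 2) - i) • u, ⟨hrec x hx _ (by linarith), ?_⟩,
      orthogonalProjection_add_smul _ _⟩
    rw [mem_sphere_zero_iff_norm, ← sq_eq_sq₀ (norm_nonneg _) hR.le, norm_sq_add_smul_unit hu]
    have h3 := Real.sq_sqrt (show 0 ≤ R ^ 2 - ‖x‖ ^ 2 + i ^ 2 by nlinarith)
    change ‖x‖ ^ 2 + 2 * (√(R ^ 2 - ‖x‖ ^ 2 + i ^ 2) - i) * i + _ = _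
    linear_combination h3

/-- When `G` is open, a point of the sphere can be pushed slightly down along `u`, into the open
ball but still above the equator. The image of the sphere piece is thus the projection of an open
set. -/
lemma projection_inter_sphere_eq_of_isOpen {u : L} (hu : ‖u‖ = 1) {R : ℝ} (hR : 0 < R) {G : Set L}
    (hG : IsOpen G) (hrec : ∀ x ∈ G, ∀ t : ℝ, 0 ≤ t → x + t • u ∈ G)
    (hpos : ∀ x ∈ G, ‖x‖ = R → 0 < inner ℝ u x) :
    (ℝ ∙ u)ᗮ.orthogonalProjectionOnto '' (G ∩ sphere 0 R) =
      (ℝ ∙ u)ᗮ.orthogonalProjectionOnto '' (G ∩ ball 0 R ∩ {x | 0 < inner ℝ u x}) := by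
  apply Subset.antisymm
  · rintro _ ⟨x, ⟨hx, hxR⟩, rfl⟩
    rw [mem_sphere_zero_iff_norm] at hxR
    have h0 := hpos x hx hxR
    have hcont : Tendsto (fun t : ℝ => x + (-t) • u) (𝓝[>] 0) (𝓝 x) := by
      have : Continuous (fun t : ℝ => x + (-t) • u) := by fun_prop
      simpa using (this.tendsto 0).mono_left nhdsWithin_le_nhds
    obtain ⟨t, ht, ht0, ht1⟩ := ((hcont.eventually (hG.mem_nhds hx)).and
      (Ioo_mem_nhdsGT h0)).exists
    refine ⟨x + (-t) • u, ⟨⟨ht, ?_⟩, ?_⟩, orthogonalProjection_add_smul _ _⟩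
    · rw [mem_ball_zero_iff, ← sq_lt_sq₀ (norm_nonneg _) hR.le, norm_sq_add_smul_unit hu, hxR]
      nlinarith
    · rw [mem_ofPred_eq, inner_add_right, inner_smul_right, real_inner_self_eq_norm_sq, hu]
      linarith
  · rw [projection_inter_sphere_eq hu hR hrec hpos]
    apply image_mono
    rintro x ⟨⟨hx, hxR⟩, hx0⟩
    exact ⟨⟨hx, ball_subset_closedBall hxR⟩, le_of_lt (show 0 < inner ℝ u x from hx0)⟩

lemma exists_homeomorph_eucl_unitBall {m : ℕ} {W : Type*} [NormedAddCommGroup W]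
    [InnerProductSpace ℝ W] [FiniteDimensional ℝ W] (hm : Module.finrank ℝ W = m) {B : Set W}
    (hc : Convex ℝ B) (hne : (interior B).Nonempty) (hb : Bornology.IsBounded B) :
    ∃ h : W ≃ₜ E m, h '' interior B = ball 0 1 ∧ h '' closure B = closedBall 0 1 := by
  obtain ⟨h, h1, h2, -⟩ := exists_homeomorph_image_interior_closure_frontier_eq_unitBall hc hne hb
  let e : W ≃ₗᵢ[ℝ] E m := ((stdOrthonormalBasis ℝ W).reindex (finCongr hm)).repr
  refine ⟨h.trans e.toHomeomorph, ?_, ?_⟩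
  · exact (image_comp e h _).trans (by rw [h1]; simp)
  · exact (image_comp e h _).trans (by rw [h2]; simp)

lemma finrank_orthogonal_span_unit {m : ℕ} (hm : Module.finrank ℝ L = m + 1) {u : L}
    (hu : ‖u‖ = 1) : Module.finrank ℝ (ℝ ∙ u)ᗮ = m := by
  have : Fact (Module.finrank ℝ L = m + 1) := ⟨hm⟩
  exact Submodule.finrank_orthogonal_span_singleton (by rintro rfl; simp at hu)

lemma convex_projection_inter_sphere {u : L} (hu : ‖u‖ = 1) {R : ℝ} (hR : 0 < R) {G : Set L}
    (hconv : Convex ℝ G) (hrec : ∀ x ∈ G, ∀ t : ℝ, 0 ≤ t → x + t • u ∈ G)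
    (hpos : ∀ x ∈ G, ‖x‖ = R → 0 < inner ℝ u x) :
    Convex ℝ ((ℝ ∙ u)ᗮ.orthogonalProjectionOnto '' (G ∩ sphere 0 R)) := by
  rw [projection_inter_sphere_eq hu hR hrec hpos]
  refine ((hconv.inter (convex_closedBall _ _)).inter ?_).linear_image
    (ℝ ∙ u)ᗮ.orthogonalProjectionOnto.toLinearMap
  exact convex_halfSpace_ge (innerSL ℝ u).toLinearMap.isLinear 0

lemma isBounded_projection_inter_sphere (u : L) (R : ℝ) (G : Set L) :
    Bornology.IsBounded ((ℝ ∙ u)ᗮ.orthogonalProjectionOnto '' (G ∩ sphere 0 R)) :=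
  ((ℝ ∙ u)ᗮ.orthogonalProjectionOnto.lipschitz.isBounded_image
    (isBounded_sphere.subset inter_subset_right))

variable [FiniteDimensional ℝ L]

lemma isOpen_projection_inter_sphere {u : L} (hu : ‖u‖ = 1) {R : ℝ} (hR : 0 < R) {G : Set L}
    (hG : IsOpen G) (hrec : ∀ x ∈ G, ∀ t : ℝ, 0 ≤ t → x + t • u ∈ G)
    (hpos : ∀ x ∈ G, ‖x‖ = R → 0 < inner ℝ u x) :
    IsOpen ((ℝ ∙ u)ᗮ.orthogonalProjectionOnto '' (G ∩ sphere 0 R)) := by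
  rw [projection_inter_sphere_eq_of_isOpen hu hR hG hrec hpos]
  have hpole : IsOpen {x : L | 0 < inner ℝ u x} :=
    isOpen_lt continuous_const (continuous_const.inner continuous_id)
  refine ContinuousLinearMap.isOpenMap (ℝ ∙ u)ᗮ.orthogonalProjectionOnto (fun y => ⟨y, ?_⟩) _
    ((hG.inter isOpen_ball).inter hpole)
  exact Submodule.orthogonalProjectionOnto_mem_subspace_eq_self y

/-- An open convex set that recedes in the direction of the pole cuts an open topological ball out
of a sphere, provided that it meets this sphere in the upper hemisphere only. -/
lemma nonempty_homeomorph_inter_sphere_ball {m : ℕ} (hm : Module.finrank ℝ L = m + 1) {u : L}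
    (hu : ‖u‖ = 1) {R : ℝ} (hR : 0 < R) {G : Set L} (hconv : Convex ℝ G) (hG : IsOpen G)
    (hrec : ∀ x ∈ G, ∀ t : ℝ, 0 ≤ t → x + t • u ∈ G)
    (hpos : ∀ x ∈ G, ‖x‖ = R → 0 < inner ℝ u x) (hne : (G ∩ sphere 0 R).Nonempty) :
    Nonempty (↥(G ∩ sphere 0 R) ≃ₜ ball (0 : E m) 1) := by
  have hO := isOpen_projection_inter_sphere hu hR hG hrec hpos
  obtain ⟨h, h1, -⟩ := exists_homeomorph_eucl_unitBall (finrank_orthogonal_span_unit hm hu)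
    (convex_projection_inter_sphere hu hR hconv hrec hpos)
    (by rw [hO.interior_eq]; exact hne.image _) (isBounded_projection_inter_sphere u R G)
  rw [hO.interior_eq] at h1
  obtain ⟨e⟩ := nonempty_homeomorph_projection_of_hemisphere hu (R := R) (F := G ∩ sphere 0 R)
    (fun x hx => by simpa using hx.2) (fun x hx => hpos x hx.1 (by simpa using hx.2))
  exact ⟨(e.trans (h.image _)).trans (Homeomorph.setCongr h1)⟩

/-- `G` is meant to be a closed cell and `G'` the open cell in it. The projection of `G'` supplies
the interior points that make the compact convex projection of `G` a closed ball. -/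
lemma nonempty_homeomorph_inter_sphere_closedBall {m : ℕ} (hm : Module.finrank ℝ L = m + 1)
    {u : L} (hu : ‖u‖ = 1) {R : ℝ} (hR : 0 < R) {G : Set L} (hconv : Convex ℝ G) (hG : IsClosed G)
    (hrec : ∀ x ∈ G, ∀ t : ℝ, 0 ≤ t → x + t • u ∈ G)
    (hpos : ∀ x ∈ G, ‖x‖ = R → 0 < inner ℝ u x) {G' : Set L} (hG' : IsOpen G') (hsub : G' ⊆ G)
    (hrec' : ∀ x ∈ G', ∀ t : ℝ, 0 ≤ t → x + t • u ∈ G') (hne : (G' ∩ sphere 0 R).Nonempty) :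
    Nonempty (↥(G ∩ sphere 0 R) ≃ₜ closedBall (0 : E m) 1) := by
  have hO := isOpen_projection_inter_sphere hu hR hG' hrec' (fun x hx => hpos x (hsub hx))
  have hB : IsCompact ((ℝ ∙ u)ᗮ.orthogonalProjectionOnto '' (G ∩ sphere 0 R)) :=
    ((isCompact_sphere _ _).inter_left hG).image (by fun_prop)
  obtain ⟨h, -, h1⟩ := exists_homeomorph_eucl_unitBall (finrank_orthogonal_span_unit hm hu)
    (convex_projection_inter_sphere hu hR hconv hrec hpos)
    ((hne.image _).mono (interior_maximal (image_mono (inter_subset_inter_left _ hsub)) hO))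
    (isBounded_projection_inter_sphere u R G)
  rw [hB.isClosed.closure_eq] at h1
  obtain ⟨e⟩ := nonempty_homeomorph_projection_of_hemisphere hu (R := R) (F := G ∩ sphere 0 R)
    (fun x hx => by simpa using hx.2) (fun x hx => hpos x hx.1 (by simpa using hx.2))
  exact ⟨(e.trans (h.image _)).trans (Homeomorph.setCongr h1)⟩

end BallPoly

end SphericalGraph

/-! ### Farthest-point Voronoi cells and their duality with Delaunay faces -/

namespace BallPoly

open Metric Set Filter Topology

section VoronoiCells

variable {d : ℕ} {C S : Set (E d)} {s : E d}

/-- The affine function whose sign tells whether `s` is at least as far from `x` as `c`. -/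
noncomputable def gap (s c x : E d) : ℝ := 2 * inner ℝ x (c - s) + (‖s‖ ^ 2 - ‖c‖ ^ 2)

lemma gap_eq (s c x : E d) : gap s c x = dist x s ^ 2 - dist x c ^ 2 := by
  rw [gap, dist_eq_norm, dist_eq_norm, norm_sub_sq_real, norm_sub_sq_real, inner_sub_right]
  ring

lemma dist_le_dist_iff_gap {s c x : E d} : dist x c ≤ dist x s ↔ 0 ≤ gap s c x := by
  rw [gap_eq, sub_nonneg, sq_le_sq₀ dist_nonneg dist_nonneg]

lemma dist_eq_dist_iff_gap {s c x : E d} : dist x c = dist x s ↔ gap s c x = 0 := by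
  rw [gap_eq, sub_eq_zero, sq_eq_sq₀ dist_nonneg dist_nonneg, eq_comm]

lemma gap_add (s c x v : E d) : gap s c (x + v) = gap s c x + 2 * inner ℝ v (c - s) := by
  simp only [gap, inner_add_left]; ring

lemma gap_combo {a b : ℝ} (hab : a + b = 1) (s c x y : E d) :
    gap s c (a • x + b • y) = a * gap s c x + b * gap s c y := by
  simp only [gap, inner_add_left, inner_smul_left, RCLike.conj_to_real]
  linear_combination (-(‖s‖ ^ 2 - ‖c‖ ^ 2)) * hab

lemma continuous_gap (s c : E d) : Continuous (gap s c) := by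
  unfold gap; fun_prop

/-- The points for which all points of `S` are farthest: the closure of the cell of `S`, if this is
nonempty. -/
def cellHull (C S : Set (E d)) : Set (E d) := {x | S ⊆ farthestPoints C x}

lemma mem_cellHull_iff (hS : S ⊆ C) (hs : s ∈ S) {x : E d} :
    x ∈ cellHull C S ↔ (∀ c ∈ C, 0 ≤ gap s c x) ∧ ∀ c ∈ S, gap s c x = 0 := by
  constructor
  · intro h
    refine ⟨fun c hc => dist_le_dist_iff_gap.1 ((h hs).2 c hc), fun c hc => ?_⟩
    exact dist_eq_dist_iff_gap.1 (le_antisymm ((h hs).2 c (hS hc)) ((h hc).2 s (hS hs)))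
  · rintro ⟨h1, h2⟩ c hc
    refine ⟨hS hc, fun c' hc' => ?_⟩
    rw [dist_eq_dist_iff_gap.2 (h2 c hc)]
    exact dist_le_dist_iff_gap.2 (h1 c' hc')

lemma mem_cell_iff (hS : S ⊆ C) (hs : s ∈ S) {x : E d} :
    x ∈ cell C S ↔ (∀ c ∈ C \ S, 0 < gap s c x) ∧ ∀ c ∈ S, gap s c x = 0 := by
  constructor
  · intro h
    have h' : farthestPoints C x = S := h
    obtain ⟨h1, h2⟩ := (mem_cellHull_iff hS hs).1 (show x ∈ cellHull C S from h'.ge)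
    refine ⟨fun c hc => (h1 c hc.1).lt_of_ne fun h0 => hc.2 ?_, h2⟩
    rw [← h']
    refine ⟨hc.1, fun c' hc' => ?_⟩
    rw [dist_eq_dist_iff_gap.2 h0.symm]
    exact dist_le_dist_iff_gap.2 (h1 c' hc')
  · rintro ⟨h1, h2⟩
    have hx : x ∈ cellHull C S := by
      refine (mem_cellHull_iff hS hs).2 ⟨fun c hc => ?_, h2⟩
      by_cases hcS : c ∈ S
      · exact (h2 c hcS).ge
      · exact (h1 c ⟨hc, hcS⟩).le
    refine Subset.antisymm (fun c hc => ?_) hx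
    by_contra hcS
    exact (h1 c ⟨hc.1, hcS⟩).not_ge (by
      have := hc.2 s (hS hs)
      rw [gap_eq, sub_nonpos]; gcongr)

lemma cell_subset_cellHull : cell C S ⊆ cellHull C S := fun _ hx => Eq.ge hx

lemma farthestPoints_subset (C : Set (E d)) (x : E d) : farthestPoints C x ⊆ C := fun _ h => h.1

lemma farthestPoints_nonempty (hC : C.Finite) (hne : C.Nonempty) (x : E d) :
    (farthestPoints C x).Nonempty := by
  obtain ⟨c, hc, h⟩ := hC.exists_maximalFor (fun c => dist x c) C hne
  exact ⟨c, hc, fun c' hc' => (le_total _ _).elim (fun h' => h') (fun h' => h hc' h')⟩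

lemma nonempty_of_cell_nonempty (hC : C.Finite) (hne : C.Nonempty) (h : (cell C S).Nonempty) :
    S.Nonempty := by
  obtain ⟨x, hx⟩ := h
  rw [← show farthestPoints C x = S from hx]
  exact farthestPoints_nonempty hC hne x

lemma mem_voronoiDiagram_iff {V : Set (E d)} :
    V ∈ voronoiDiagram C ↔ ∃ S ⊆ C, (cell C S).Nonempty ∧ V = cell C S := by
  constructor
  · rintro ⟨y, rfl⟩
    exact ⟨farthestPoints C y, farthestPoints_subset C y, ⟨y, rfl⟩, rfl⟩
  · rintro ⟨S, -, ⟨y, hy⟩, rfl⟩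
    exact ⟨y, by rw [← show farthestPoints C y = S from hy]; rfl⟩

lemma cell_mem_voronoiDiagram_iff : cell C S ∈ voronoiDiagram C ↔ (cell C S).Nonempty := by
  constructor
  · rintro h
    obtain ⟨T, -, h1, h2⟩ := mem_voronoiDiagram_iff.1 h
    exact h2 ▸ h1
  · rintro ⟨y, hy⟩
    exact ⟨y, by rw [← show farthestPoints C y = S from hy]; rfl⟩

lemma isClosed_cellHull (hS : S ⊆ C) (hs : s ∈ S) : IsClosed (cellHull C S) := by
  have : cellHull C S = (⋂ c ∈ C, {x | 0 ≤ gap s c x}) ∩ ⋂ c ∈ S, {x | gap s c x = 0} := by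
    ext x
    simp [mem_cellHull_iff hS hs]
  rw [this]
  exact (isClosed_biInter fun c _ => isClosed_le continuous_const (continuous_gap s c)).inter
    (isClosed_biInter fun c _ => isClosed_eq (continuous_gap s c) continuous_const)

lemma convex_cellHull (hS : S ⊆ C) (hs : s ∈ S) : Convex ℝ (cellHull C S) := by
  intro x hx y hy a b ha hb hab
  rw [mem_cellHull_iff hS hs] at *
  refine ⟨fun c hc => ?_, fun c hc => ?_⟩
  · rw [gap_combo hab]
    exact add_nonneg (mul_nonneg ha (hx.1 c hc)) (mul_nonneg hb (hy.1 c hc))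
  · rw [gap_combo hab, hx.2 c hc, hy.2 c hc]; simp

/-- A positive weight at the point of the cell keeps every strict inequality strict. -/
lemma combo_mem_cell (hS : S ⊆ C) (hs : s ∈ S) {x y : E d} (hx : x ∈ cell C S)
    (hy : y ∈ cellHull C S) {a b : ℝ} (ha : 0 < a) (hb : 0 ≤ b) (hab : a + b = 1) :
    a • x + b • y ∈ cell C S := by
  rw [mem_cell_iff hS hs] at *
  rw [mem_cellHull_iff hS hs] at hy
  refine ⟨fun c hc => ?_, fun c hc => ?_⟩
  · rw [gap_combo hab]
    exact add_pos_of_pos_of_nonneg (mul_pos ha (hx.1 c hc)) (mul_nonneg hb (hy.1 c hc.1))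
  · rw [gap_combo hab, hx.2 c hc, hy.2 c hc]; simp

lemma convex_cell (hS : S ⊆ C) (hs : s ∈ S) : Convex ℝ (cell C S) := by
  intro x hx y hy a b ha hb hab
  rcases ha.eq_or_lt with rfl | ha
  · rw [zero_add] at hab
    simpa [hab] using hy
  · exact combo_mem_cell hS hs hx (cell_subset_cellHull hy) ha hb hab

lemma tendsto_combo (x y : E d) :
    Tendsto (fun t : ℝ => t • x + (1 - t) • y) (𝓝[>] 0) (𝓝 y) := by
  have : Continuous (fun t : ℝ => t • x + (1 - t) • y) := by fun_prop
  simpa using (this.tendsto 0).mono_left nhdsWithin_le_nhds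

lemma closure_cell (hS : S ⊆ C) (hs : s ∈ S) (hne : (cell C S).Nonempty) :
    closure (cell C S) = cellHull C S := by
  apply Subset.antisymm (closure_minimal cell_subset_cellHull (isClosed_cellHull hS hs))
  intro y hy
  obtain ⟨x, hx⟩ := hne
  refine mem_closure_of_tendsto (tendsto_combo x y) ?_
  filter_upwards [Ioo_mem_nhdsGT (zero_lt_one' ℝ)] with t ht
  exact combo_mem_cell hS hs hx hy ht.1 (by linarith [ht.2]) (by ring)

lemma mem_vectorSpan_orthogonal_iff (hs : s ∈ S) {v : E d} :
    v ∈ (vectorSpan ℝ S)ᗮ ↔ ∀ c ∈ S, inner ℝ v (c - s) = 0 := by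
  rw [vectorSpan_eq_span_vsub_set_right ℝ hs, Submodule.mem_orthogonal']
  constructor
  · exact fun h c hc => h _ (Submodule.subset_span ⟨c, hc, rfl⟩)
  · intro h w hw
    induction hw using Submodule.span_induction with
    | mem w hw => obtain ⟨c, hc, rfl⟩ := hw; exact h c hc
    | zero => simp
    | add a b _ _ h1 h2 => rw [inner_add_right, h1, h2, add_zero]
    | smul a b _ h1 => rw [inner_smul_right, h1, mul_zero]

lemma eventually_gap_pos (hC : C.Finite) (hS : S ⊆ C) (hs : s ∈ S) {x : E d} (hx : x ∈ cell C S) :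
    ∀ᶠ y in 𝓝 x, ∀ c ∈ C \ S, 0 < gap s c y :=
  (eventually_all_finite hC.sdiff).2 fun c hc =>
    (continuous_gap s c).continuousAt.eventually (lt_mem_nhds (((mem_cell_iff hS hs).1 hx).1 c hc))

lemma eventually_add_smul_mem_cell (hC : C.Finite) (hS : S ⊆ C) {x v : E d} (hx : x ∈ cell C S)
    (hs : s ∈ S) (hv : v ∈ (vectorSpan ℝ S)ᗮ) : ∀ᶠ t : ℝ in 𝓝 0, x + t • v ∈ cell C S := by
  have hcont : Tendsto (fun t : ℝ => x + t • v) (𝓝 0) (𝓝 x) := by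
    have : Continuous (fun t : ℝ => x + t • v) := by fun_prop
    simpa using this.tendsto 0
  filter_upwards [hcont.eventually (eventually_gap_pos hC hS hs hx)] with t ht
  refine (mem_cell_iff hS hs).2 ⟨ht, fun c hc => ?_⟩
  rw [gap_add, ((mem_cell_iff hS hs).1 hx).2 c hc, inner_smul_left,
    (mem_vectorSpan_orthogonal_iff hs).1 hv c hc]
  simp

lemma sub_mem_vectorSpan_orthogonal (hS : S ⊆ C) (hs : s ∈ S) {x y : E d}
    (hx : x ∈ cellHull C S) (hy : y ∈ cellHull C S) : x - y ∈ (vectorSpan ℝ S)ᗮ := by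
  refine (mem_vectorSpan_orthogonal_iff hs).2 fun c hc => ?_
  have h1 := ((mem_cellHull_iff hS hs).1 hx).2 c hc
  have h2 := ((mem_cellHull_iff hS hs).1 hy).2 c hc
  have h3 := gap_add s c y (x - y)
  rw [add_sub_cancel, h1, h2] at h3
  linarith

/-- A move orthogonal to `S` preserves the equalities exactly and, if small, the finitely many
strict inequalities. Conversely, equality of the gaps at two points makes their difference
orthogonal to `S`. -/
lemma vectorSpan_cell (hC : C.Finite) (hS : S ⊆ C) (hs : s ∈ S) (hne : (cell C S).Nonempty) :
    vectorSpan ℝ (cell C S) = (vectorSpan ℝ S)ᗮ := by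
  apply le_antisymm
  · refine Submodule.span_le.2 ?_
    rintro _ ⟨x, hx, y, hy, rfl⟩
    exact sub_mem_vectorSpan_orthogonal hS hs (cell_subset_cellHull hx) (cell_subset_cellHull hy)
  · intro v hv
    obtain ⟨x, hx⟩ := hne
    obtain ⟨t, ht, ht0⟩ := (((eventually_add_smul_mem_cell hC hS hx hs hv).filter_mono
      nhdsWithin_le_nhds).and (self_mem_nhdsWithin (a := (0 : ℝ)) (s := Ioi 0))).exists
    have h := vsub_mem_vectorSpan ℝ ht hx
    rw [vsub_eq_sub, add_sub_cancel_left] at h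
    exact (Submodule.smul_mem_iff _ (ne_of_gt (show 0 < t from ht0))).1 h

lemma setDim_cell_add (hC : C.Finite) (hS : S ⊆ C) (hs : s ∈ S) (hne : (cell C S).Nonempty) :
    setDim S + setDim (cell C S) = d := by
  rw [setDim, setDim, vectorSpan_cell hC hS hs hne, Submodule.finrank_add_finrank_orthogonal]
  simp

lemma setDim_convexHull (S : Set (E d)) : setDim (convexHull ℝ S) = setDim S := by
  rw [setDim, setDim, ← direction_affineSpan, affineSpan_convexHull, direction_affineSpan]

namespace IsPolytopeVertexSet

variable (hC : IsPolytopeVertexSet C)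
include hC

lemma nonempty : C.Nonempty := by
  rw [nonempty_iff_ne_empty]
  rintro rfl
  have := hC.full_dim
  simp at this

lemma vectorSpan_eq_top : vectorSpan ℝ C = ⊤ := by
  rw [← direction_affineSpan, ← affineSpan_convexHull, hC.full_dim, AffineSubspace.direction_top]

lemma eq_zero_of_forall_inner (hs : s ∈ C) {v : E d} (h : ∀ c ∈ C, inner ℝ v (c - s) = 0) :
    v = 0 := by
  have := (mem_vectorSpan_orthogonal_iff hs).2 h
  simpa [hC.vectorSpan_eq_top] using this

lemma notMem_convexHull_sdiff {c : E d} (hc : c ∈ C) : c ∉ convexHull ℝ (C \ {c}) := by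
  intro h
  rw [← hC.vertices, (convex_convexHull ℝ _).mem_extremePoints_iff_convex_sdiff] at hc
  refine (convexHull_min ?_ hc.2 h).2 rfl
  exact sdiff_subset_sdiff_left (subset_convexHull ℝ C)

/-- Points of `S` are extreme in `conv C`, hence extreme in `conv S = conv T`, hence in `T`. This
makes a Delaunay face determine its cell. -/
lemma eq_of_convexHull_eq {T : Set (E d)} (hS : S ⊆ C) (hT : T ⊆ C)
    (h : convexHull ℝ S = convexHull ℝ T) : S = T := by
  suffices H : ∀ {S T : Set (E d)}, S ⊆ C → convexHull ℝ S = convexHull ℝ T → S ⊆ T from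
    Subset.antisymm (H hS h) (H hT h.symm)
  intro S T hS h c hc
  apply extremePoints_convexHull_subset (𝕜 := ℝ)
  rw [← h]
  refine inter_extremePoints_subset_extremePoints_of_subset (convexHull_mono hS)
    ⟨subset_convexHull ℝ _ hc, ?_⟩
  rw [hC.vertices]
  exact hS hc

lemma convexHull_mem_delaunayComplex_iff (hS : S ⊆ C) :
    convexHull ℝ S ∈ delaunayComplex C ↔ (cell C S).Nonempty := by
  constructor
  · rintro ⟨T, hT, hne, h⟩
    rwa [hC.eq_of_convexHull_eq hS hT h]
  · exact fun h => ⟨S, hS, h, rfl⟩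

lemma isVoronoiFace_iff (hS : S ⊆ C) {k : ℕ} (hk : k ≤ d) :
    IsVoronoiFace C k (cell C S) ↔
      convexHull ℝ S ∈ delaunayComplex C ∧ setDim (convexHull ℝ S) = d - k := by
  rw [IsVoronoiFace, cell_mem_voronoiDiagram_iff, hC.convexHull_mem_delaunayComplex_iff hS,
    setDim_convexHull]
  refine and_congr_right fun hne => ?_
  obtain ⟨s, hs⟩ := nonempty_of_cell_nonempty hC.finite hC.nonempty hne
  have := setDim_cell_add hC.finite hS hs hne
  omega

end IsPolytopeVertexSet

end VoronoiCells

end BallPoly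

/-! ### Bounded and receding cells, and the boundary Delaunay complex -/

namespace BallPoly

open Metric Set Filter Topology

section BoundaryFaces

variable {d : ℕ} {C S : Set (E d)} {s : E d} {r : ℝ}

lemma mem_ballPolyhedron_iff {x : E d} : x ∈ ballPolyhedron C r ↔ ∀ c ∈ C, dist x c ≤ r := by
  simp [ballPolyhedron]

lemma mem_interior_ballPolyhedron_iff (hC : C.Finite) (hr : 0 < r) {x : E d} :
    x ∈ interior (ballPolyhedron C r) ↔ ∀ c ∈ C, dist x c < r := by
  constructor
  · intro hx c hc
    have : ballPolyhedron C r ⊆ closedBall c r := biInter_subset_of_mem hc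
    have := interior_mono this hx
    rwa [interior_closedBall _ hr.ne'] at this
  · intro hx
    refine mem_interior.2 ⟨⋂ c ∈ C, ball c r, ?_, hC.isOpen_biInter fun c _ => isOpen_ball, ?_⟩
    · exact iInter₂_mono fun c _ => ball_subset_closedBall
    · simpa using hx

lemma isClosed_ballPolyhedron : IsClosed (ballPolyhedron C r) :=
  isClosed_biInter fun _ _ => isClosed_closedBall

lemma mem_interior_ballPolyhedron_iff_of_mem_cellHull (hC : C.Finite) (hr : 0 < r) (hs : s ∈ S)
    {x : E d} (hx : x ∈ cellHull C S) :
    x ∈ interior (ballPolyhedron C r) ↔ dist x s < r := by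
  rw [mem_interior_ballPolyhedron_iff hC hr]
  exact ⟨fun h => h s (hx hs).1, fun h c hc => ((hx hs).2 c hc).trans_lt h⟩

/-- As `s` is farthest from `x`, it alone decides whether `x` is in the polyhedron or in its
interior. -/
lemma mem_frontier_ballPolyhedron_iff_of_mem_cellHull (hC : C.Finite) (hr : 0 < r) (hs : s ∈ S)
    {x : E d} (hx : x ∈ cellHull C S) :
    x ∈ frontier (ballPolyhedron C r) ↔ dist x s = r := by
  have h : x ∈ ballPolyhedron C r ↔ dist x s ≤ r := by
    rw [mem_ballPolyhedron_iff]
    exact ⟨fun h => h s (hx hs).1, fun h c hc => ((hx hs).2 c hc).trans h⟩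
  rw [isClosed_ballPolyhedron.frontier_eq, Set.mem_sdiff, h,
    mem_interior_ballPolyhedron_iff_of_mem_cellHull hC hr hs hx, not_lt, le_antisymm_iff]

/-- The directions in which the cell of `S ∋ s` recedes. -/
def recessionCone (C S : Set (E d)) (s : E d) : Set (E d) :=
  {v | (∀ c ∈ C, 0 ≤ inner ℝ v (c - s)) ∧ ∀ c ∈ S, inner ℝ v (c - s) = 0}

lemma smul_mem_recessionCone {v : E d} (hv : v ∈ recessionCone C S s) {t : ℝ} (ht : 0 ≤ t) :
    t • v ∈ recessionCone C S s := by
  refine ⟨fun c hc => ?_, fun c hc => ?_⟩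
  · rw [inner_smul_left]; exact mul_nonneg ht (hv.1 c hc)
  · rw [inner_smul_left, hv.2 c hc, mul_zero]

lemma add_mem_cell (hS : S ⊆ C) (hs : s ∈ S) {x v : E d} (hx : x ∈ cell C S)
    (hv : v ∈ recessionCone C S s) : x + v ∈ cell C S := by
  rw [mem_cell_iff hS hs] at *
  refine ⟨fun c hc => ?_, fun c hc => ?_⟩
  · rw [gap_add]; linarith [hx.1 c hc, hv.1 c hc.1]
  · rw [gap_add]; linarith [hx.2 c hc, hv.2 c hc]

lemma add_mem_cellHull (hS : S ⊆ C) (hs : s ∈ S) {x v : E d} (hx : x ∈ cellHull C S)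
    (hv : v ∈ recessionCone C S s) : x + v ∈ cellHull C S := by
  rw [mem_cellHull_iff hS hs] at *
  refine ⟨fun c hc => ?_, fun c hc => ?_⟩
  · rw [gap_add]; linarith [hx.1 c hc, hv.1 c hc]
  · rw [gap_add]; linarith [hx.2 c hc, hv.2 c hc]

lemma exists_ne_zero_of_setDim_ne_zero {V : Set (E d)} (h : setDim V ≠ 0) :
    ∃ v ∈ vectorSpan ℝ V, v ≠ 0 := by
  apply Submodule.exists_mem_ne_zero_of_ne_bot
  rintro h0
  simp [setDim, h0] at h

lemma mem_cell_farthestPoints (y : E d) : y ∈ cell C (farthestPoints C y) := rfl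

lemma cellHull_farthestPoints_subset {y : E d} (hy : y ∈ cellHull C S) :
    cellHull C (farthestPoints C y) ⊆ cellHull C S := fun _ hx => Subset.trans hy hx

lemma isVoronoiFace_cell_farthestPoints (y : E d) :
    IsVoronoiFace C (setDim (cell C (farthestPoints C y))) (cell C (farthestPoints C y)) :=
  ⟨cell_mem_voronoiDiagram_iff.2 ⟨y, mem_cell_farthestPoints y⟩, rfl⟩

/-- On a bounded closed cell, the distance to a point of `S` is maximal at a vertex. -/
lemma exists_vertex_dist_ge (hC : C.Finite) (hS : S ⊆ C) (hs : s ∈ S)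
    (hb : Bornology.IsBounded (cellHull C S)) {x : E d} (hx : x ∈ cellHull C S) :
    ∃ y ∈ cellHull C S, dist x s ≤ dist y s ∧ setDim (cell C (farthestPoints C y)) = 0 := by
  have hcomp : IsCompact (cellHull C S) := isCompact_of_isClosed_isBounded
    (isClosed_cellHull hS hs) hb
  obtain ⟨y, hy, hmax⟩ := hcomp.exists_isMaxOn ⟨x, hx⟩
    (f := fun x => dist x s) (by fun_prop)
  refine ⟨y, hy, hmax hx, ?_⟩
  by_contra h0
  obtain ⟨v, hv, hv0⟩ := exists_ne_zero_of_setDim_ne_zero h0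
  rw [vectorSpan_cell hC (farthestPoints_subset C y) (hy hs) ⟨y, mem_cell_farthestPoints y⟩] at hv
  have h1 := eventually_add_smul_mem_cell hC (farthestPoints_subset C y)
    (mem_cell_farthestPoints y) (hy hs) hv
  have h2 : ∀ᶠ t : ℝ in 𝓝 0, y + (-t) • v ∈ cell C (farthestPoints C y) := by
    have : Tendsto (fun t : ℝ => -t) (𝓝 0) (𝓝 0) := by
      simpa using (continuous_neg (G := ℝ)).tendsto 0
    exact this.eventually h1
  obtain ⟨t, ⟨ht1, ht2⟩, ht0⟩ := (((h1.and h2).filter_mono nhdsWithin_le_nhds).and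
    (self_mem_nhdsWithin (a := (0 : ℝ)) (s := Ioi 0))).exists
  have k1 : dist (y + t • v) s ≤ dist y s :=
    hmax (cellHull_farthestPoints_subset hy (cell_subset_cellHull ht1))
  have k2 : dist (y + (-t) • v) s ≤ dist y s :=
    hmax (cellHull_farthestPoints_subset hy (cell_subset_cellHull ht2))
  rw [dist_eq_norm, dist_eq_norm] at k1 k2
  -- Strict convexity: `y` is the midpoint of two distinct points of the closed cell, so one of them
  -- is farther from `s` than `y`.
  have k3 := parallelogram_law_with_norm ℝ (y - s) (t • v)
  rw [show y - s + t • v = y + t • v - s by abel,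
    show y - s - t • v = y + (-t) • v - s by rw [neg_smul]; abel] at k3
  have k4 : 0 < ‖t • v‖ := norm_pos_iff.2 (smul_ne_zero (ne_of_gt ht0) hv0)
  nlinarith [norm_nonneg (y + t • v - s), norm_nonneg (y + (-t) • v - s)]

/-- Moving from `x` in a direction along which the points of `S` stay equally far, while another
point catches up, one reaches a point with more farthest points. -/
lemma exists_ssubset_farthestPoints (hC : C.Finite) {x v : E d} (hs : s ∈ farthestPoints C x)
    (hv : ∀ c ∈ farthestPoints C x, inner ℝ v (c - s) = 0) (hex : ∃ c ∈ C, inner ℝ v (c - s) < 0) :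
    ∃ y, farthestPoints C x ⊂ farthestPoints C y := by
  have hS := farthestPoints_subset C x
  have hx := (mem_cell_iff hS hs).1 (mem_cell_farthestPoints x)
  set N : Set (E d) := {c ∈ C | inner ℝ v (c - s) < 0}
  have hN : N.Finite := hC.subset fun c hc => hc.1
  -- `c₀` is the first point to catch up with `s` on the ray, and the ratio is the time when its gap
  -- vanishes.
  obtain ⟨c₀, hc₀, hmin⟩ := hN.exists_minimalFor (fun c => gap s c x / (-2 * inner ℝ v (c - s))) N hex
  have hc₀' : c₀ ∉ farthestPoints C x := fun h => by
    have := hc₀.2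
    rw [hv c₀ h] at this
    exact this.false
  set t := gap s c₀ x / (-2 * inner ℝ v (c₀ - s)) with ht
  have ht0 : 0 ≤ t := div_nonneg (hx.1 c₀ ⟨hc₀.1, hc₀'⟩).le (by linarith [hc₀.2])
  have hgap : ∀ c, gap s c (x + t • v) = gap s c x + t * (2 * inner ℝ v (c - s)) := by
    intro c
    rw [gap_add, inner_smul_left, RCLike.conj_to_real]
    ring
  have hy : x + t • v ∈ cellHull C (farthestPoints C x) := by
    refine (mem_cellHull_iff hS hs).2 ⟨fun c hc => ?_, fun c hc => ?_⟩
    · rw [hgap]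
      by_cases hcN : inner ℝ v (c - s) < 0
      · have hle : t ≤ gap s c x / (-2 * inner ℝ v (c - s)) :=
          (le_total _ _).elim id (fun h => hmin ⟨hc, hcN⟩ h)
        rw [le_div_iff₀ (by linarith)] at hle
        linarith
      · have h1 := ((mem_cellHull_iff hS hs).1 (cell_subset_cellHull
          (mem_cell_farthestPoints x))).1 c hc
        have h2 : 0 ≤ t * (2 * inner ℝ v (c - s)) := mul_nonneg ht0 (by linarith)
        linarith
    · rw [hgap, hx.2 c hc, hv c hc]; simp
  refine ⟨x + t • v, hy, fun h => hc₀' (h ⟨hc₀.1, fun c hc => ?_⟩)⟩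
  have h0 : gap s c₀ (x + t • v) = 0 := by
    rw [hgap, ht]
    field_simp [hc₀.2.ne]
    ring
  rw [dist_eq_dist_iff_gap.2 h0]
  exact (hy hs).2 c hc

/-- Take a point of the closed cell with inclusion-maximal farthest set. If its own cell had a
nonzero direction, some point of `C` would catch up along this direction or its opposite, because
`C` affinely spans the space; the farthest set would grow. -/
lemma IsPolytopeVertexSet.exists_vertex_mem_cellHull (hC : IsPolytopeVertexSet C)
    (hne : (cellHull C S).Nonempty) :
    ∃ y ∈ cellHull C S, setDim (cell C (farthestPoints C y)) = 0 := by
  have hfin : (farthestPoints C '' cellHull C S).Finite :=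
    hC.finite.finite_subsets.subset (by rintro _ ⟨x, -, rfl⟩; exact farthestPoints_subset C x)
  obtain ⟨_, ⟨x, hx, rfl⟩, hmax⟩ := hfin.exists_maximal (hne.image _)
  refine ⟨x, hx, ?_⟩
  by_contra h0
  obtain ⟨v, hv, hv0⟩ := exists_ne_zero_of_setDim_ne_zero h0
  obtain ⟨s, hs⟩ := farthestPoints_nonempty hC.finite hC.nonempty x
  rw [vectorSpan_cell hC.finite (farthestPoints_subset C x) hs
    ⟨x, mem_cell_farthestPoints x⟩, mem_vectorSpan_orthogonal_iff hs] at hv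
  have hex : ∃ w : E d, (∀ c ∈ farthestPoints C x, inner ℝ w (c - s) = 0) ∧
      ∃ c ∈ C, inner ℝ w (c - s) < 0 := by
    by_contra! hcon
    refine hv0 (hC.eq_zero_of_forall_inner (farthestPoints_subset C x hs) fun c hc => ?_)
    have h1 := hcon v hv c hc
    have h2 := hcon (-v) (fun c hc => by rw [inner_neg_left, hv c hc, neg_zero]) c hc
    rw [inner_neg_left] at h2
    linarith
  obtain ⟨w, hw1, hw2⟩ := hex
  obtain ⟨y, hy⟩ := exists_ssubset_farthestPoints hC.finite hs hw1 hw2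
  exact hy.not_subset (hmax ⟨y, hx.trans hy.subset, rfl⟩ hy.subset)

lemma le_inner_of_mem_convexHull {X : Set (E d)} {v s : E d} {a : ℝ}
    (h : ∀ c ∈ X, a ≤ inner ℝ v (c - s)) {q : E d} (hq : q ∈ convexHull ℝ X) :
    a ≤ inner ℝ v (q - s) := by
  have hconv : Convex ℝ {q : E d | a + inner ℝ v s ≤ inner ℝ v q} :=
    convex_halfSpace_ge (innerSL ℝ v).toLinearMap.isLinear _
  have : q ∈ {q : E d | a + inner ℝ v s ≤ inner ℝ v q} := by
    refine convexHull_min (fun c hc => ?_) hconv hq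
    have := h c hc
    rw [inner_sub_right] at this
    rw [mem_ofPred_eq]
    linarith
  rw [mem_ofPred_eq] at this
  rw [inner_sub_right]
  linarith

/-- If `conv S` meets the interior of `conv C`, then the cell of `S` is bounded. -/
lemma isBounded_cellHull (hC : C.Finite) (hS : S ⊆ C) (hs : s ∈ S)
    (h : ¬ convexHull ℝ S ⊆ frontier (convexHull ℝ C)) :
    Bornology.IsBounded (cellHull C S) := by
  obtain ⟨p, hpS, hp⟩ := not_subset.1 h
  have hpi : p ∈ interior (convexHull ℝ C) := by
    by_contra hcon
    exact hp ⟨subset_closure (convexHull_mono hS hpS), hcon⟩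
  obtain ⟨ε, hε, hball⟩ := Metric.nhds_basis_closedBall.mem_iff.1 (mem_interior_iff_mem_nhds.1 hpi)
  rcases (cellHull C S).eq_empty_or_nonempty with he | ⟨x₀, hx₀⟩
  · rw [he]; exact Bornology.isBounded_empty
  obtain ⟨M, hM⟩ := (hC.image fun c => gap s c x₀).bddAbove
  refine (Metric.isBounded_iff_subset_closedBall x₀).2 ⟨M / 2 / ε, fun x hx => ?_⟩
  have hv := (mem_vectorSpan_orthogonal_iff hs).1 (sub_mem_vectorSpan_orthogonal hS hs hx hx₀)
  have hx' := ((mem_cellHull_iff hS hs).1 hx).1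
  rw [mem_closedBall, dist_eq_norm, le_div_iff₀ hε]
  set v := x - x₀ with hvdef
  have h1 : ∀ c ∈ C, -(M / 2) ≤ inner ℝ v (c - s) := by
    intro c hc
    have k1 := gap_add s c x₀ v
    rw [hvdef, add_sub_cancel, ← hvdef] at k1
    have k2 := hx' c hc
    have k3 : gap s c x₀ ≤ M := hM ⟨c, hc, rfl⟩
    linarith
  have h2 : inner ℝ v (p - s) ≤ 0 := by
    have := le_inner_of_mem_convexHull (v := -v) (s := s) (a := 0)
      (fun c hc => by rw [inner_neg_left, hv c hc, neg_zero]) hpS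
    rw [inner_neg_left] at this
    linarith
  rcases eq_or_ne v 0 with h0 | h0
  · rw [h0, norm_zero, zero_mul]
    have := h1 s (hS hs)
    rw [h0, inner_zero_left] at this
    linarith
  have hn : 0 < ‖v‖ := norm_pos_iff.2 h0
  -- The test point lies at distance `ε` from `p`, against `v`. It is in `conv C`, so `-M / 2 ≤ ⟨v,
  -- p - s⟩ - ε * ‖v‖`, which bounds `‖v‖`.
  have h3 := le_inner_of_mem_convexHull h1 (q := p - (ε / ‖v‖) • v) (hball (by
    rw [mem_closedBall, dist_eq_norm, sub_sub_cancel_left, norm_neg, norm_smul, Real.norm_eq_abs,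
      abs_of_pos (div_pos hε hn), div_mul_cancel₀ _ hn.ne']))
  rw [sub_right_comm, inner_sub_right, inner_smul_right, real_inner_self_eq_norm_sq, pow_two,
    ← mul_assoc, div_mul_cancel₀ _ hn.ne'] at h3
  linarith

/-- If `conv S` lies in the boundary of `conv C`, then the cell of `S` recedes in some direction. -/
lemma IsPolytopeVertexSet.exists_ne_zero_mem_recessionCone (hC : IsPolytopeVertexSet C)
    (hS : S ⊆ C) (hs : s ∈ S) (h : convexHull ℝ S ⊆ frontier (convexHull ℝ C)) :
    ∃ u ∈ recessionCone C S s, u ≠ 0 := by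
  have hfin := hC.finite.subset hS
  set A := hfin.toFinset
  have hA : A.Nonempty := ⟨s, hfin.mem_toFinset.2 hs⟩
  have hcard : (0 : ℝ) < A.card := by exact_mod_cast hA.card_pos
  have hz : A.centerMass (fun _ => (1 : ℝ)) id ∈ convexHull ℝ S := by
    have := A.centerMass_id_mem_convexHull (R := ℝ) (w := fun _ => 1) (by simp) (by simpa using hcard)
    rwa [hfin.coe_toFinset] at this
  -- A functional supporting `conv C` at the centroid of `S` is at most `f z` on `S` with mean `f
  -- z`, hence constant on `S`.
  set z := A.centerMass (fun _ => (1 : ℝ)) id with hzdef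
  have hint : (interior (convexHull ℝ C)).Nonempty := by
    rw [interior_convexHull_nonempty_iff_affineSpan_eq_top, ← affineSpan_convexHull, hC.full_dim]
  obtain ⟨f, hf⟩ := geometric_hahn_banach_open_point (convex_convexHull ℝ C).interior
    isOpen_interior (h hz).2
  have hle : ∀ c ∈ C, f c ≤ f z := by
    have hcl : closure (interior (convexHull ℝ C)) ⊆ {c | f c ≤ f z} :=
      closure_minimal (fun c hc => (hf c hc).le) (isClosed_le f.continuous continuous_const)
    rw [(convex_convexHull ℝ C).closure_interior_eq_closure_of_nonempty_interior hint] at hcl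
    exact fun c hc => hcl (subset_closure (subset_convexHull ℝ C hc))
  have heq : ∀ c ∈ S, f c = f z := by
    have hsum : ∑ c ∈ A, (f z - f c) = 0 := by
      have : f z = (A.card : ℝ)⁻¹ * ∑ c ∈ A, f c := by
        simp [hzdef, Finset.centerMass]
      rw [Finset.sum_sub_distrib, Finset.sum_const, nsmul_eq_mul, this]
      field_simp
      ring
    have := (Finset.sum_eq_zero_iff_of_nonneg fun c hc =>
      sub_nonneg.2 (hle c (hS (hfin.mem_toFinset.1 hc)))).1 hsum
    intro c hc
    linarith [this c (hfin.mem_toFinset.2 hc)]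
  set u := (InnerProductSpace.toDual ℝ (E d)).symm f
  have hu : ∀ x, inner ℝ u x = f x := fun x => InnerProductSpace.toDual_symm_apply
  refine ⟨-u, ⟨fun c hc => ?_, fun c hc => ?_⟩, fun h0 => ?_⟩
  · rw [inner_neg_left, hu, map_sub, heq s hs]
    linarith [hle c hc]
  · rw [inner_neg_left, hu, map_sub, heq s hs, heq c hc]
    simp
  · obtain ⟨x, hx⟩ := hint
    have := hf x hx
    rw [← hu, ← hu, neg_eq_zero.1 h0, inner_zero_left, inner_zero_left] at this
    exact this.false

lemma exists_dist_add_smul_gt {x u : E d} (hu : u ≠ 0) (s : E d) (r : ℝ) :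
    ∃ t : ℝ, 0 < t ∧ r < dist (x + t • u) s := by
  have hn : 0 < ‖u‖ := norm_pos_iff.2 hu
  refine ⟨(|r| + ‖x - s‖ + 1) / ‖u‖, by positivity, ?_⟩
  set t := (|r| + ‖x - s‖ + 1) / ‖u‖ with ht
  have h1 : ‖t • u‖ = |r| + ‖x - s‖ + 1 := by
    rw [norm_smul, Real.norm_eq_abs, abs_of_nonneg (by positivity), ht, div_mul_cancel₀ _ hn.ne']
  have h2 := norm_sub_le (x + t • u - s) (x - s)
  rw [show x + t • u - s - (x - s) = t • u by abel, h1] at h2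
  rw [dist_eq_norm]
  linarith [le_abs_self r]

/-- A cell that recedes in some direction and contains a point of the interior of the ball
polyhedron meets its boundary. -/
lemma cell_inter_frontier_nonempty (hC : C.Finite) (hr : 0 < r) (hS : S ⊆ C) (hs : s ∈ S) {u : E d}
    (hu : u ∈ recessionCone C S s) (hu0 : u ≠ 0) {x : E d} (hx : x ∈ cell C S)
    (hxr : dist x s < r) : (cell C S ∩ frontier (ballPolyhedron C r)).Nonempty := by
  obtain ⟨t₁, ht₁, h1⟩ := exists_dist_add_smul_gt (x := x) hu0 s r
  have hcont : Continuous fun t : ℝ => dist (x + t • u) s := by fun_prop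
  obtain ⟨t, ht, hdist⟩ := intermediate_value_Icc ht₁.le hcont.continuousOn
    (show r ∈ Icc _ _ from ⟨by simpa using hxr.le, h1.le⟩)
  have hmem := add_mem_cell hS hs hx (smul_mem_recessionCone hu ht.1)
  exact ⟨_, hmem, (mem_frontier_ballPolyhedron_iff_of_mem_cellHull hC hr hs
    (cell_subset_cellHull hmem)).2 hdist⟩

/-- If all vertices of the Voronoi diagram are interior to the ball polyhedron, then so are the
bounded cells. -/
lemma dist_lt_of_isBounded_cellHull (hC : C.Finite) (hr : 0 < r)
    (hvert : ∀ V, IsVoronoiFace C 0 V → V ⊆ interior (ballPolyhedron C r)) (hS : S ⊆ C)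
    (hs : s ∈ S) (hb : Bornology.IsBounded (cellHull C S)) {x : E d} (hx : x ∈ cellHull C S) :
    dist x s < r := by
  obtain ⟨y, hy, hle, h0⟩ := exists_vertex_dist_ge hC hS hs hb hx
  refine hle.trans_lt ((mem_interior_ballPolyhedron_iff_of_mem_cellHull hC hr hs hy).1 ?_)
  have := isVoronoiFace_cell_farthestPoints (C := C) y
  rw [h0] at this
  exact hvert _ this (mem_cell_farthestPoints y)

lemma convexHull_subset_frontier_of_cellHull_inter (hC : C.Finite) (hr : 0 < r)
    (hvert : ∀ V, IsVoronoiFace C 0 V → V ⊆ interior (ballPolyhedron C r)) (hS : S ⊆ C)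
    (hs : s ∈ S) (h : (cellHull C S ∩ frontier (ballPolyhedron C r)).Nonempty) :
    convexHull ℝ S ⊆ frontier (convexHull ℝ C) := by
  by_contra hcon
  obtain ⟨x, hx, hxf⟩ := h
  have := dist_lt_of_isBounded_cellHull hC hr hvert hS hs (isBounded_cellHull hC hS hs hcon) hx
  rw [mem_frontier_ballPolyhedron_iff_of_mem_cellHull hC hr hs hx] at hxf
  exact this.ne hxf

/-- For the converse a ray needs a starting point of the cell inside the polyhedron. The closed cell
contains a Voronoi vertex, which is interior by `hvert`, and the cell has points arbitrarily close
to it. -/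
lemma IsPolytopeVertexSet.cell_inter_frontier_nonempty_iff (hC : IsPolytopeVertexSet C) (hr : 0 < r)
    (hvert : ∀ V, IsVoronoiFace C 0 V → V ⊆ interior (ballPolyhedron C r)) (hS : S ⊆ C)
    (hs : s ∈ S) (hne : (cell C S).Nonempty) :
    (cell C S ∩ frontier (ballPolyhedron C r)).Nonempty ↔
      convexHull ℝ S ⊆ frontier (convexHull ℝ C) := by
  constructor
  · exact fun h => convexHull_subset_frontier_of_cellHull_inter hC.finite hr hvert hS hs
      (h.mono (inter_subset_inter_left _ cell_subset_cellHull))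
  · intro h
    obtain ⟨u, hu, hu0⟩ := hC.exists_ne_zero_mem_recessionCone hS hs h
    obtain ⟨x, hx⟩ := hne
    obtain ⟨y, hy, h0⟩ := hC.exists_vertex_mem_cellHull ⟨x, cell_subset_cellHull hx⟩
    have hface := isVoronoiFace_cell_farthestPoints (C := C) y
    rw [h0] at hface
    have hyr := (mem_interior_ballPolyhedron_iff_of_mem_cellHull hC.finite hr hs hy).1
      (hvert _ hface (mem_cell_farthestPoints y))
    have hnear : ∀ᶠ z in 𝓝 y, dist z s < r :=
      (isOpen_lt (continuous_id.dist continuous_const) continuous_const).mem_nhds hyr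
    obtain ⟨t, ht, ht0, ht1⟩ := (((tendsto_combo x y).eventually hnear).and
      (Ioo_mem_nhdsGT (zero_lt_one' ℝ))).exists
    exact cell_inter_frontier_nonempty hC.finite hr hS hs hu hu0
      (combo_mem_cell hS hs hx hy ht0 (by linarith) (by ring)) ht

lemma IsPolytopeVertexSet.isFace_iff (hC : IsPolytopeVertexSet C) (hbasic : IsBasic C r)
    (hS : S ⊆ C) {k : ℕ} (hk1 : 1 ≤ k) (hk : k ≤ d) :
    IsFace C r (k - 1) (cell C S ∩ frontier (ballPolyhedron C r)) ↔
      convexHull ℝ S ∈ boundaryDelaunayComplex C ∧ setDim (convexHull ℝ S) = d - k := by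
  have hbd : convexHull ℝ S ∈ boundaryDelaunayComplex C ↔ convexHull ℝ S ∈ delaunayComplex C ∧
    convexHull ℝ S ⊆ frontier (convexHull ℝ C) := Iff.rfl
  rw [hbd, and_right_comm, ← hC.isVoronoiFace_iff hS hk]
  constructor
  · rintro ⟨V, hV, hne, heq⟩
    rw [Nat.sub_add_cancel hk1] at hV
    obtain ⟨T, -, -, rfl⟩ := mem_voronoiDiagram_iff.1 hV.1
    -- Distinct cells are disjoint, so the nonempty face remembers its cell.
    have hST : S = T := by
      rw [← heq] at hne
      obtain ⟨x, hx⟩ := hne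
      have hx' := heq ▸ hx
      exact Eq.trans (show farthestPoints C x = S from hx.1).symm hx'.1
    subst hST
    obtain ⟨s, hs⟩ := nonempty_of_cell_nonempty hC.finite hC.nonempty (hne.mono inter_subset_left)
    exact ⟨hV, (hC.cell_inter_frontier_nonempty_iff hbasic.pos hbasic.vertices_mem hS hs
      (hne.mono inter_subset_left)).1 hne⟩
  · rintro ⟨hV, hsub⟩
    have hne := cell_mem_voronoiDiagram_iff.1 hV.1
    obtain ⟨s, hs⟩ := nonempty_of_cell_nonempty hC.finite hC.nonempty hne
    refine ⟨cell C S, by rwa [Nat.sub_add_cancel hk1], ?_, rfl⟩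
    exact (hC.cell_inter_frontier_nonempty_iff hbasic.pos hbasic.vertices_mem hS hs hne).2 hsub

end BoundaryFaces

end BallPoly

/-! ### Poles of recession cones, and faces for large radius -/

namespace BallPoly

open Metric Set Filter Topology

section LargeRadius

variable {d : ℕ} {C S : Set (E d)} {s : E d} {r : ℝ}

lemma add_mem_recessionCone {v w : E d} (hv : v ∈ recessionCone C S s)
    (hw : w ∈ recessionCone C S s) : v + w ∈ recessionCone C S s := by
  refine ⟨fun c hc => ?_, fun c hc => ?_⟩
  · rw [inner_add_left]; exact add_nonneg (hv.1 c hc) (hw.1 c hc)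
  · rw [inner_add_left, hv.2 c hc, hw.2 c hc, add_zero]

lemma convex_recessionCone : Convex ℝ (recessionCone C S s) := fun _ hx _ hy _ _ ha hb _ =>
  add_mem_recessionCone (smul_mem_recessionCone hx ha) (smul_mem_recessionCone hy hb)

lemma isClosed_recessionCone : IsClosed (recessionCone C S s) := by
  have : recessionCone C S s =
      (⋂ c ∈ C, {v | 0 ≤ inner ℝ v (c - s)}) ∩ ⋂ c ∈ S, {v | inner ℝ v (c - s) = 0} := by
    ext x
    simp [recessionCone]
  rw [this]
  exact (isClosed_biInter fun c _ => isClosed_le continuous_const (by fun_prop)).inter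
    (isClosed_biInter fun c _ => isClosed_eq (by fun_prop) continuous_const)

/-- A nontrivial recession cone contains a unit vector that makes an acute angle with each of its
nonzero vectors. -/
lemma IsPolytopeVertexSet.exists_pole (hC : IsPolytopeVertexSet C) (hs : s ∈ C)
    (hne : ∃ u ∈ recessionCone C S s, u ≠ 0) :
    ∃ u ∈ recessionCone C S s, ‖u‖ = 1 ∧
      ∀ v ∈ recessionCone C S s, v ≠ 0 → 0 < inner ℝ u v := by
  set w : E d := ∑ c ∈ hC.finite.toFinset, (c - s)
  have hw : ∀ v ∈ recessionCone C S s, v ≠ 0 → 0 < inner ℝ w v := by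
    intro v hv hv0
    have hnn : ∀ c ∈ hC.finite.toFinset, 0 ≤ inner ℝ v (c - s) := fun c hc =>
      hv.1 c (hC.finite.mem_toFinset.1 hc)
    rw [real_inner_comm, inner_sum]
    refine (Finset.sum_nonneg hnn).lt_of_ne fun h0 => hv0 ?_
    refine hC.eq_zero_of_forall_inner hs fun c hc => ?_
    exact (Finset.sum_eq_zero_iff_of_nonneg hnn).1 h0.symm c (hC.finite.mem_toFinset.2 hc)
  obtain ⟨v₀, hv₀, hv₀'⟩ := hne
  -- `w` has the right angles but need not lie in the cone. For its nearest point `u` in the cone,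
  -- `⟨w - u, v⟩ ≤ 0` for every `v` in the cone, so `⟨u, v⟩ ≥ ⟨w, v⟩ > 0`.
  obtain ⟨u, hu, hmin⟩ := exists_norm_eq_iInf_of_complete_convex ⟨v₀, hv₀⟩
    isClosed_recessionCone.isComplete convex_recessionCone w
  rw [norm_eq_iInf_iff_real_inner_le_zero convex_recessionCone hu] at hmin
  have hpos : ∀ v ∈ recessionCone C S s, v ≠ 0 → 0 < inner ℝ u v := by
    intro v hv hv0
    have h1 := hmin (u + v) (add_mem_recessionCone hu hv)
    rw [add_sub_cancel_left, inner_sub_left] at h1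
    linarith [hw v hv hv0]
  have hu0 : u ≠ 0 := by
    rintro rfl
    simpa using hpos v₀ hv₀ hv₀'
  have hn : 0 < ‖u‖⁻¹ := inv_pos.2 (norm_pos_iff.2 hu0)
  refine ⟨‖u‖⁻¹ • u, smul_mem_recessionCone hu hn.le, ?_, fun v hv hv0 => ?_⟩
  · rw [norm_smul, norm_inv, norm_norm, inv_mul_cancel₀ (norm_ne_zero_iff.2 hu0)]
  · rw [inner_smul_left]
    exact mul_pos hn (hpos v hv hv0)

/-- Far away from `s`, the cell of `S ∋ s` lies on the positive side of the hyperplane through `s`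
that is orthogonal to the pole `u`. -/
lemma eventually_inner_pos (hC : C.Finite) (hS : S ⊆ C) (hs : s ∈ S) {u : E d}
    (hu : ∀ v ∈ recessionCone C S s, v ≠ 0 → 0 < inner ℝ u v) :
    ∀ᶠ r : ℝ in atTop, ∀ x ∈ cellHull C S, dist x s = r → 0 < inner ℝ u (x - s) := by
  rcases (cellHull C S).eq_empty_or_nonempty with he | ⟨x₀, hx₀⟩
  · simp [he]
  -- `h` measures how far `v` is from being a recession direction with `⟨u, v⟩ ≤ 0`. On the
  -- orthogonal complement of `vectorSpan ℝ S` it vanishes only at `0`; being positively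
  -- homogeneous, it is at least `δ * ‖v‖` there. For `v = x - x₀`, with `x` in the closed cell and
  -- `⟨u, x - s⟩ ≤ 0`, it is bounded.
  let h : E d → ℝ := fun v =>
    max (inner ℝ u v) 0 + ∑ c ∈ hC.toFinset, max (-inner ℝ v (c - s)) 0
  have hcont : Continuous h := by fun_prop
  have hsum : ∀ v, 0 ≤ ∑ c ∈ hC.toFinset, max (-inner ℝ v (c - s)) 0 := fun v =>
    Finset.sum_nonneg fun c _ => le_max_right _ _
  have hpos : ∀ v ∈ sphere (0 : E d) 1 ∩ ((vectorSpan ℝ S)ᗮ : Submodule ℝ (E d)), 0 < h v := by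
    rintro v ⟨hv1, hv⟩
    have hv0 : v ≠ 0 := by rintro rfl; simp at hv1
    by_contra hcon
    have k1 : max (inner ℝ u v) 0 = 0 :=
      le_antisymm (by linarith [hsum v, show h v = _ + _ from rfl]) (le_max_right _ _)
    have k2 : ∑ c ∈ hC.toFinset, max (-inner ℝ v (c - s)) 0 = 0 :=
      le_antisymm (by linarith [show h v = _ + _ from rfl]) (hsum v)
    rw [Finset.sum_eq_zero_iff_of_nonneg fun c _ => le_max_right _ _] at k2
    refine (hu v ⟨fun c hc => ?_, (mem_vectorSpan_orthogonal_iff hs).1 hv⟩ hv0).not_ge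
      (max_eq_right_iff.1 k1)
    linarith [max_eq_right_iff.1 (k2 c (hC.mem_toFinset.2 hc))]
  have hcomp : IsCompact (sphere (0 : E d) 1 ∩ ((vectorSpan ℝ S)ᗮ : Submodule ℝ (E d))) :=
    (isCompact_sphere _ _).inter_right (Submodule.closed_of_finiteDimensional _)
  obtain ⟨δ, hδ, hmin⟩ : ∃ δ : ℝ, 0 < δ ∧
      ∀ v ∈ sphere (0 : E d) 1 ∩ ((vectorSpan ℝ S)ᗮ : Submodule ℝ (E d)), δ ≤ h v := by
    rcases (sphere (0 : E d) 1 ∩ ((vectorSpan ℝ S)ᗮ : Submodule ℝ (E d)) :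
      Set (E d)).eq_empty_or_nonempty with he | hne
    · exact ⟨1, one_pos, by simp [he]⟩
    · obtain ⟨v, hv, hvmin⟩ := hcomp.exists_isMinOn hne hcont.continuousOn
      exact ⟨h v, hpos v hv, fun w hw => hvmin hw⟩
  have hgrow : ∀ v ∈ (vectorSpan ℝ S)ᗮ, δ * ‖v‖ ≤ h v := by
    intro v hv
    rcases eq_or_ne v 0 with rfl | hv0
    · simp [h]
    have hn : 0 < ‖v‖ := norm_pos_iff.2 hv0
    have k1 := hmin (‖v‖⁻¹ • v) ⟨by simp [norm_smul, hn.ne'], Submodule.smul_mem _ _ hv⟩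
    have k2 : h v = ‖v‖ * h (‖v‖⁻¹ • v) := by
      simp only [h, mul_add, Finset.mul_sum, mul_max_of_nonneg _ _ hn.le, inner_smul_left,
        inner_smul_right, RCLike.conj_to_real, mul_zero, ← mul_neg, mul_inv_cancel_left₀ hn.ne']
    rw [k2, mul_comm]
    gcongr
  obtain ⟨M, hM⟩ := (hC.image fun c => gap s c x₀).bddAbove
  have hM0 : 0 ≤ M := by
    have : gap s s x₀ ≤ M := hM ⟨s, hS hs, rfl⟩
    simpa [gap] using this
  filter_upwards [eventually_gt_atTop
    ((‖x₀ - s‖ + ∑ c ∈ hC.toFinset, M / 2) / δ + ‖x₀ - s‖ + |inner ℝ u (x₀ - s)| / δ)]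
    with r hr x hx hxr
  by_contra hcon
  have hv := sub_mem_vectorSpan_orthogonal hS hs hx hx₀
  set v := x - x₀ with hvdef
  have k1 : inner ℝ u v ≤ |inner ℝ u (x₀ - s)| := by
    have : x - s = v + (x₀ - s) := by rw [hvdef]; abel
    rw [this, inner_add_right] at hcon
    linarith [neg_abs_le (inner ℝ u (x₀ - s))]
  have k2 : ∑ c ∈ hC.toFinset, max (-inner ℝ v (c - s)) 0 ≤ ∑ c ∈ hC.toFinset, M / 2 := by
    refine Finset.sum_le_sum fun c hc => max_le ?_ (by positivity)
    have hc := hC.mem_toFinset.1 hc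
    have j1 := gap_add s c x₀ v
    rw [hvdef, add_sub_cancel, ← hvdef] at j1
    have j2 := ((mem_cellHull_iff hS hs).1 hx).1 c hc
    have j3 : gap s c x₀ ≤ M := hM ⟨c, hc, rfl⟩
    linarith
  have k3 : δ * ‖v‖ ≤ |inner ℝ u (x₀ - s)| + ∑ c ∈ hC.toFinset, M / 2 :=
    (hgrow v hv).trans (add_le_add (max_le k1 (abs_nonneg _)) k2)
  have k4 : ‖v‖ ≤ (|inner ℝ u (x₀ - s)| + ∑ c ∈ hC.toFinset, M / 2) / δ := by
    rw [le_div_iff₀ hδ]; linarith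
  have k5 : r ≤ ‖v‖ + ‖x₀ - s‖ := by
    rw [← hxr, dist_eq_norm, show x - s = v + (x₀ - s) by rw [hvdef]; abel]
    exact norm_add_le _ _
  have k6 : 0 ≤ ‖x₀ - s‖ / δ := by positivity
  rw [add_div] at hr k4
  linarith

/-- The cells whose Delaunay faces lie in the boundary cut topological balls out of the boundaries
of large ball polyhedra. -/
lemma eventually_topBall_of_pole (hC : C.Finite) (hS : S ⊆ C) (hs : s ∈ S)
    (hne : (cell C S).Nonempty) {u : E d} (hu : u ∈ recessionCone C S s) (hu1 : ‖u‖ = 1)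
    (hpole : ∀ v ∈ recessionCone C S s, v ≠ 0 → 0 < inner ℝ u v) {m : ℕ}
    (hm : setDim (cell C S) = m + 1) :
    ∀ᶠ r : ℝ in atTop, (cell C S ∩ frontier (ballPolyhedron C r)).Nonempty →
      IsOpenTopBall m (cell C S ∩ frontier (ballPolyhedron C r)) ∧
        IsClosedTopBall m (cellHull C S ∩ frontier (ballPolyhedron C r)) := by
  have hdim : Module.finrank ℝ (vectorSpan ℝ S)ᗮ = m + 1 := by
    rw [← vectorSpan_cell hC hS hs hne]; exact hm
  set L := (vectorSpan ℝ S)ᗮ with hL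
  obtain ⟨x₀, hx₀⟩ := hne
  have hx₀' := cell_subset_cellHull hx₀
  -- `p` is the foot of the perpendicular from `s` to the affine hull of the cell. With `p` as
  -- origin, the sphere about `s` meets this hull in a sphere about `0` in `L`, of radius `R` below.
  obtain ⟨p, hp₀, hps⟩ : ∃ p, x₀ - p ∈ L ∧ p - s ∈ Lᗮ := by
    refine ⟨x₀ + L.starProjection (s - x₀), ?_, ?_⟩
    · rw [sub_add_cancel_left]
      exact L.neg_mem (Submodule.starProjection_apply_mem _ _)
    · have := Lᗮ.neg_mem (Submodule.sub_starProjection_mem_orthogonal (K := L) (s - x₀))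
      convert this using 1
      abel
  have hnorm : ∀ v : L, dist (p + v) s ^ 2 = dist p s ^ 2 + ‖v‖ ^ 2 := by
    intro v
    rw [dist_eq_norm, dist_eq_norm, show p + v - s = (p - s) + v by abel, norm_add_sq_real,
      Submodule.inner_left_of_mem_orthogonal v.2 hps]
    simp
  have huL : u ∈ L := (mem_vectorSpan_orthogonal_iff hs).2 hu.2
  let φ : L → E d := fun v => p + v
  have hφ : Isometry φ := (IsometryEquiv.addLeft p).isometry.comp isometry_subtype_coe
  have hrange : ∀ x ∈ cellHull C S, x ∈ range φ := by
    intro x hx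
    have h1 := L.add_mem (sub_mem_vectorSpan_orthogonal hS hs hx hx₀') hp₀
    exact ⟨⟨_, h1⟩, by simp [φ]⟩
  have hgapS : ∀ v : L, ∀ c ∈ S, gap s c (p + v) = 0 := by
    intro v c hc
    have h1 := gap_add s c x₀ (p + v - x₀)
    have h2 : p + v - x₀ ∈ L := by
      have := L.sub_mem v.2 hp₀
      convert this using 1
      abel
    rw [add_sub_cancel, (mem_vectorSpan_orthogonal_iff hs).1 h2 c hc,
      ((mem_cellHull_iff hS hs).1 hx₀').2 c hc] at h1
    simpa using h1
  have hopen : IsOpen (φ ⁻¹' cell C S) := by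
    rw [isOpen_iff_mem_nhds]
    intro v hv
    filter_upwards [hφ.continuous.continuousAt.eventually (eventually_gap_pos hC hS hs hv)] with w hw
    exact (mem_cell_iff hS hs).2 ⟨hw, hgapS w⟩
  have hconv : ∀ {K : Set (E d)}, Convex ℝ K → Convex ℝ (φ ⁻¹' K) := fun hK =>
    (hK.translate_preimage_right p).linear_preimage L.subtype
  have hshift : ∀ (v : L) (t : ℝ), φ (v + t • (⟨u, huL⟩ : L)) = φ v + t • u := by
    intro v t
    simp [φ, add_assoc]
  have hrec : ∀ v ∈ φ ⁻¹' cell C S, ∀ t : ℝ, 0 ≤ t → v + t • (⟨u, huL⟩ : L) ∈ φ ⁻¹' cell C S := by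
    intro v hv t ht
    rw [mem_preimage, hshift]
    exact add_mem_cell hS hs hv (smul_mem_recessionCone hu ht)
  have hrec' : ∀ v ∈ φ ⁻¹' cellHull C S, ∀ t : ℝ, 0 ≤ t →
      v + t • (⟨u, huL⟩ : L) ∈ φ ⁻¹' cellHull C S := by
    intro v hv t ht
    rw [mem_preimage, hshift]
    exact add_mem_cellHull hS hs hv (smul_mem_recessionCone hu ht)
  filter_upwards [eventually_inner_pos hC hS hs hpole, eventually_gt_atTop (dist p s)]
    with r hpos hr hface
  have hr0 : 0 < r := dist_nonneg.trans_lt hr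
  have hR2 : 0 < r ^ 2 - dist p s ^ 2 := by
    have : dist p s ^ 2 < r ^ 2 := by gcongr
    linarith
  set R := √(r ^ 2 - dist p s ^ 2)
  have hR : 0 < R := Real.sqrt_pos.2 hR2
  have hRsq : R ^ 2 = r ^ 2 - dist p s ^ 2 := Real.sq_sqrt hR2.le
  have hdist : ∀ v : L, dist (φ v) s = r ↔ ‖v‖ = R := by
    intro v
    rw [← sq_eq_sq₀ dist_nonneg hr0.le, ← sq_eq_sq₀ (norm_nonneg v) hR.le, hRsq, hnorm]
    constructor <;> intro h <;> linarith
  have himage : ∀ K ⊆ cellHull C S,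
      φ '' (φ ⁻¹' K ∩ sphere 0 R) = K ∩ frontier (ballPolyhedron C r) := by
    intro K hK
    ext x
    constructor
    · rintro ⟨v, ⟨hv, hvR⟩, rfl⟩
      exact ⟨hv, (mem_frontier_ballPolyhedron_iff_of_mem_cellHull hC hr0 hs (hK hv)).2
        ((hdist v).2 (by simpa using hvR))⟩
    · rintro ⟨hx, hxf⟩
      obtain ⟨v, rfl⟩ := hrange x (hK hx)
      refine ⟨v, ⟨hx, ?_⟩, rfl⟩
      rw [mem_sphere_zero_iff_norm, ← hdist]
      exact (mem_frontier_ballPolyhedron_iff_of_mem_cellHull hC hr0 hs (hK hx)).1 hxf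
  have hpos' : ∀ v ∈ φ ⁻¹' cellHull C S, ‖v‖ = R → 0 < inner ℝ (⟨u, huL⟩ : L) v := by
    intro v hv hvR
    have h1 := hpos _ hv ((hdist v).2 hvR)
    rwa [show φ v - s = (p - s) + v by simp only [φ]; abel, inner_add_right,
      Submodule.inner_right_of_mem_orthogonal huL hps, zero_add] at h1
  have hsub : φ ⁻¹' cell C S ⊆ φ ⁻¹' cellHull C S := preimage_mono cell_subset_cellHull
  have hne' : (φ ⁻¹' cell C S ∩ sphere 0 R).Nonempty := by
    rwa [← himage _ cell_subset_cellHull, image_nonempty] at hface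
  have hu1' : ‖(⟨u, huL⟩ : L)‖ = 1 := hu1
  constructor
  · obtain ⟨e⟩ := nonempty_homeomorph_inter_sphere_ball hdim hu1' hR (hconv (convex_cell hS hs))
      hopen hrec (fun v hv => hpos' v (hsub hv)) hne'
    rw [IsOpenTopBall, ← himage _ cell_subset_cellHull]
    exact ⟨(hφ.isEmbedding.homeomorphImage _).symm.trans e⟩
  · obtain ⟨e⟩ := nonempty_homeomorph_inter_sphere_closedBall hdim hu1' hR
      (hconv (convex_cellHull hS hs)) ((isClosed_cellHull hS hs).preimage hφ.continuous) hrec' hpos'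
      hopen hsub hrec hne'
    rw [IsClosedTopBall, ← himage _ Subset.rfl]
    exact ⟨(hφ.isEmbedding.homeomorphImage _).symm.trans e⟩

end LargeRadius

end BallPoly

/-! ### Large ball polyhedra are basic and standard -/

namespace BallPoly

open Metric Set Filter Topology

section StandardBallPolyhedra

variable {d : ℕ} {C S : Set (E d)} {s : E d} {r : ℝ}

lemma eventually_subset_ball (hC : C.Finite) (p : E d) :
    ∀ᶠ r : ℝ in atTop, ∀ c ∈ C, dist p c < r :=
  (eventually_all_finite hC).2 fun _ _ => eventually_gt_atTop _

/-- A zero-dimensional cell is a single point, and there are finitely many cells. -/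
lemma eventually_vertices_mem (hC : C.Finite) :
    ∀ᶠ r : ℝ in atTop, ∀ V, IsVoronoiFace C 0 V → V ⊆ interior (ballPolyhedron C r) := by
  have h : ∀ T ∈ {T | T ⊆ C}, ∀ᶠ r : ℝ in atTop, IsVoronoiFace C 0 (cell C T) →
      cell C T ⊆ interior (ballPolyhedron C r) := by
    intro T _
    by_cases hV : IsVoronoiFace C 0 (cell C T)
    · obtain ⟨x, hx⟩ := cell_mem_voronoiDiagram_iff.1 hV.1
      filter_upwards [eventually_subset_ball hC x, eventually_gt_atTop 0] with r hr hr0 _ y hy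
      have hxy : y - x ∈ vectorSpan ℝ (cell C T) := vsub_mem_vectorSpan ℝ hy hx
      rw [Submodule.finrank_eq_zero.1 hV.2, Submodule.mem_bot, sub_eq_zero] at hxy
      rw [hxy, mem_interior_ballPolyhedron_iff hC hr0]
      exact hr
    · exact Eventually.of_forall fun r h => absurd h hV
  filter_upwards [(eventually_all_finite hC.finite_subsets).2 h] with r hr V hV
  obtain ⟨T, hT, -, rfl⟩ := mem_voronoiDiagram_iff.1 hV.1
  exact hr T hT hV

namespace IsPolytopeVertexSet

variable (hC : IsPolytopeVertexSet C)
include hC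

lemma nontrivial (hd : d ≠ 0) : C.Nontrivial := by
  by_contra h
  have h1 := vectorSpan_of_subsingleton ℝ (not_nontrivial_iff.1 h)
  rw [hC.vectorSpan_eq_top] at h1
  have h2 : Module.finrank ℝ (⊤ : Submodule ℝ (E d)) = 0 := by rw [h1]; simp
  rw [finrank_top] at h2
  simp at h2
  exact hd h2

/-- For large `r`, each vertex of a polytope can be separated from the other ones by a ball of
radius `r`. -/
lemma eventually_exists_separating_center (hd : d ≠ 0) :
    ∀ᶠ r : ℝ in atTop, ∀ c ∈ C, ∃ x, r < dist x c ∧ ∀ c' ∈ C \ {c}, dist x c' ≤ r := by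
  refine (eventually_all_finite hC.finite).2 fun c hc => ?_
  obtain ⟨f, a, hfc, hf⟩ := geometric_hahn_banach_point_closed
    (convex_convexHull ℝ (C \ {c})) (hC.finite.sdiff.isClosed_convexHull ℝ)
    (hC.notMem_convexHull_sdiff hc)
  set w := (InnerProductSpace.toDual ℝ (E d)).symm f
  have hw : ∀ x, inner ℝ w x = f x := fun x => InnerProductSpace.toDual_symm_apply
  have hpos : ∀ c' ∈ C \ {c}, 0 < inner ℝ w (c' - c) := by
    intro c' hc'
    rw [hw, map_sub]
    linarith [hf c' (subset_convexHull ℝ _ hc')]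
  have hn : 0 < ‖w‖ := by
    obtain ⟨c', hc', hne⟩ := (hC.nontrivial hd).exists_ne c
    refine norm_pos_iff.2 fun h0 => ?_
    have := hpos c' ⟨hc', hne⟩
    rw [h0, inner_zero_left] at this
    exact this.false
  have hlarge : ∀ᶠ r : ℝ in atTop, ∀ c' ∈ C \ {c},
      ‖c - c'‖ ^ 2 + 1 ≤ r * (2 * inner ℝ w (c' - c) / ‖w‖) := by
    refine (eventually_all_finite hC.finite.sdiff).2 fun c' hc' => ?_
    refine (tendsto_id.atTop_mul_const ?_).eventually_ge_atTop _
    have := hpos c' hc'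
    positivity
  filter_upwards [hlarge, eventually_gt_atTop 0] with r hr hr0
  -- The centre `c + t • w` lies at distance `√(r ^ 2 + 1)` from `c`, just too far. For the other
  -- points, the summand `1` in `hlarge` compensates for this excess.
  set t := √(r ^ 2 + 1) / ‖w‖ with ht
  have ht0 : 0 ≤ t := by positivity
  have hsq : ‖t • w‖ ^ 2 = r ^ 2 + 1 := by
    rw [norm_smul, Real.norm_eq_abs, abs_of_nonneg ht0, ht, div_mul_cancel₀ _ hn.ne',
      Real.sq_sqrt (by positivity)]
  refine ⟨c + t • w, ?_, fun c' hc' => ?_⟩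
  · rw [dist_eq_norm, add_sub_cancel_left, ← sq_lt_sq₀ hr0.le (norm_nonneg _), hsq]
    linarith
  · rw [dist_eq_norm, ← sq_le_sq₀ (norm_nonneg _) hr0.le, add_sub_right_comm, norm_add_sq_real, hsq,
      inner_smul_right, real_inner_comm, ← neg_sub c' c, inner_neg_right, norm_neg, norm_sub_rev]
    have h1 := hr c' hc'
    have h2 : r * (2 * inner ℝ w (c' - c) / ‖w‖) ≤ √(r ^ 2 + 1) * (2 * inner ℝ w (c' - c) / ‖w‖) := by
      have := hpos c' hc'
      gcongr
      exact Real.le_sqrt_of_sq_le (by linarith)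
    have h3 : √(r ^ 2 + 1) * (2 * inner ℝ w (c' - c) / ‖w‖) = 2 * (t * inner ℝ w (c' - c)) := by
      rw [ht]; ring
    linarith

lemma eventually_isBasic (hd : d ≠ 0) : ∀ᶠ r : ℝ in atTop, IsBasic C r := by
  filter_upwards [eventually_gt_atTop 0, eventually_subset_ball hC.finite 0,
    hC.eventually_exists_separating_center hd, eventually_vertices_mem hC.finite]
    with r hr0 hball hsep hvert
  refine ⟨hC, hr0, ⟨⟨0, fun c hc => by rw [mem_ball, dist_comm]; exact hball c hc⟩,
    fun c hc hmem => ?_⟩, hvert⟩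
  obtain ⟨x, hx, hx'⟩ := hsep c hc
  simp only [rConvexHull, mem_iInter] at hmem
  have := hmem x fun c' hc' => by rw [mem_closedBall, dist_comm]; exact hx' c' hc'
  rw [mem_closedBall, dist_comm] at this
  exact this.not_gt hx

lemma eventually_isReducedBallPolyhedron (hd : d ≠ 0) :
    ∀ᶠ r : ℝ in atTop, IsReducedBallPolyhedron C r := by
  filter_upwards [eventually_gt_atTop 0, eventually_subset_ball hC.finite 0,
    hC.eventually_exists_separating_center hd] with r hr0 hball hsep
  refine ⟨hr0, hC.finite, hC.nontrivial hd,
    ⟨0, (mem_interior_ballPolyhedron_iff hC.finite hr0).2 hball⟩, fun c hc heq => ?_⟩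
  obtain ⟨x, hx, hx'⟩ := hsep c hc
  have hmem : x ∈ ballPolyhedron (C \ {c}) r := mem_ballPolyhedron_iff.2 hx'
  rw [← heq, mem_ballPolyhedron_iff] at hmem
  exact (hmem c hc).not_gt hx

lemma eventually_topBall (hS : S ⊆ C) {m : ℕ} (hm : setDim (cell C S) = m + 1) :
    ∀ᶠ r : ℝ in atTop, (cell C S ∩ frontier (ballPolyhedron C r)).Nonempty →
      IsOpenTopBall m (cell C S ∩ frontier (ballPolyhedron C r)) ∧
        IsClosedTopBall m (cellHull C S ∩ frontier (ballPolyhedron C r)) := by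
  rcases (cell C S).eq_empty_or_nonempty with he | hne
  · simp [he]
  obtain ⟨s, hs⟩ := nonempty_of_cell_nonempty hC.finite hC.nonempty hne
  by_cases hbd : convexHull ℝ S ⊆ frontier (convexHull ℝ C)
  · obtain ⟨u, hu, hu1, hpole⟩ := hC.exists_pole (hS hs)
      (hC.exists_ne_zero_mem_recessionCone hS hs hbd)
    exact eventually_topBall_of_pole hC.finite hS hs hne hu hu1 hpole hm
  · filter_upwards [eventually_gt_atTop 0, eventually_vertices_mem hC.finite] with r hr hvert h
    exact absurd ((hC.cell_inter_frontier_nonempty_iff hr hvert hS hs hne).1 h) hbd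

/-- One threshold serves all `S`, as `C` has finitely many subsets and each `S` admits at most one
`m`. -/
lemma eventually_forall_topBall :
    ∀ᶠ r : ℝ in atTop, ∀ S ⊆ C, ∀ m : ℕ, setDim (cell C S) = m + 1 →
      (cell C S ∩ frontier (ballPolyhedron C r)).Nonempty →
      IsOpenTopBall m (cell C S ∩ frontier (ballPolyhedron C r)) ∧
        IsClosedTopBall m (cellHull C S ∩ frontier (ballPolyhedron C r)) := by
  refine (eventually_all_finite hC.finite.finite_subsets).2 fun S hS => ?_
  rcases h : setDim (cell C S) with _ | m
  · exact Eventually.of_forall fun r m hm => by omega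
  · filter_upwards [hC.eventually_topBall hS h] with r hr m' hm'
    obtain rfl : m = m' := by omega
    exact hr

end IsPolytopeVertexSet

/-- A nonempty set of points for which all points of `T` are farthest is the closure of a cell. -/
lemma exists_cellHull_eq (hC : C.Finite) {T : Set (E d)} (hT : T ⊆ C) (hTne : T.Nonempty)
    (hne : (cellHull C T).Nonempty) :
    ∃ S ⊆ C, T ⊆ S ∧ (cell C S).Nonempty ∧ cellHull C S = cellHull C T := by
  obtain ⟨s, hs⟩ := hTne
  have hfin : (farthestPoints C '' cellHull C T).Finite :=
    hC.finite_subsets.subset (by rintro _ ⟨x, -, rfl⟩; exact farthestPoints_subset C x)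
  obtain ⟨_, ⟨x, hx, rfl⟩, hmin⟩ := hfin.exists_minimal (hne.image _)
  refine ⟨farthestPoints C x, farthestPoints_subset C x, hx, ⟨x, rfl⟩,
    Subset.antisymm (cellHull_farthestPoints_subset hx) fun y hy => ?_⟩
  have hab : (2⁻¹ : ℝ) + 2⁻¹ = 1 := by norm_num
  -- A gap that is nonnegative at `x` and `y` and zero at their midpoint vanishes at both.
  -- Minimality at `x` then makes every farthest point of `x` one of `z`, hence one of `y`.
  set z := (2⁻¹ : ℝ) • x + (2⁻¹ : ℝ) • y
  have hz : z ∈ cellHull C T := convex_cellHull hT hs hx hy (by norm_num) (by norm_num) hab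
  have hgap : ∀ c ∈ farthestPoints C z, gap s c x = 0 ∧ gap s c y = 0 := by
    intro c hc
    have h1 := ((mem_cell_iff (farthestPoints_subset C z) (hz hs)).1 (mem_cell_farthestPoints z)).2 c hc
    rw [gap_combo hab] at h1
    have h2 := ((mem_cellHull_iff hT hs).1 hx).1 c hc.1
    have h3 := ((mem_cellHull_iff hT hs).1 hy).1 c hc.1
    constructor <;> linarith
  have hmem : ∀ {w : E d}, w ∈ cellHull C T → ∀ c ∈ C, gap s c w = 0 → c ∈ farthestPoints C w := by
    intro w hw c hc h0
    refine ⟨hc, fun c' hc' => ?_⟩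
    rw [dist_eq_dist_iff_gap.2 h0]
    exact (hw hs).2 c' hc'
  have hzx : farthestPoints C z ⊆ farthestPoints C x := fun c hc => hmem hx c hc.1 (hgap c hc).1
  exact fun c hc => hmem hy c hc.1 (hgap c (hmin ⟨z, hz, rfl⟩ hzx hc)).2

/-- A point of the polyhedron at distance `r` from `c` has no point of `C` farther away than `c`. -/
lemma iInter_sphere_inter_ballPolyhedron (hC : C.Finite) (hr : 0 < r) {T : Set (E d)} (hT : T ⊆ C)
    (hTne : T.Nonempty) :
    (⋂ c ∈ T, sphere c r) ∩ ballPolyhedron C r =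
      cellHull C T ∩ frontier (ballPolyhedron C r) := by
  obtain ⟨s, hs⟩ := hTne
  ext x
  constructor
  · rintro ⟨hx, hxP⟩
    rw [mem_iInter₂] at hx
    rw [mem_ballPolyhedron_iff] at hxP
    have hx' : x ∈ cellHull C T := fun c hc =>
      ⟨hT hc, fun c' hc' => (hxP c' hc').trans_eq (mem_sphere.1 (hx c hc)).symm⟩
    exact ⟨hx', (mem_frontier_ballPolyhedron_iff_of_mem_cellHull hC hr hs hx').2 (hx s hs)⟩
  · rintro ⟨hx, hxf⟩
    refine ⟨mem_iInter₂.2 fun c hc => ?_, isClosed_ballPolyhedron.frontier_subset hxf⟩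
    exact (mem_frontier_ballPolyhedron_iff_of_mem_cellHull hC hr hc hx).1 hxf

namespace IsPolytopeVertexSet

variable (hC : IsPolytopeVertexSet C)
include hC

lemma eventually_isStandard (hd : d ≠ 0) : ∀ᶠ r : ℝ in atTop, IsStandard C r := by
  filter_upwards [eventually_gt_atTop 0, hC.eventually_isReducedBallPolyhedron hd,
    eventually_vertices_mem hC.finite, hC.eventually_forall_topBall] with r hr hred hvert hball
  refine ⟨hred, ?_⟩
  rintro _ ⟨-, ⟨T, hT, hTne, rfl⟩, hne⟩
  rw [iInter_sphere_inter_ballPolyhedron hC.finite hr hT hTne] at hne ⊢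
  obtain ⟨S, hS, hTS, hcell, heq⟩ := exists_cellHull_eq hC.finite hT hTne (hne.mono inter_subset_left)
  obtain ⟨s, hs⟩ := hTne
  rw [← heq] at hne ⊢
  -- The closed cell meets the boundary, so `conv S` lies in the boundary of `conv C`; then the open
  -- cell meets the boundary too.
  have hface : (cell C S ∩ frontier (ballPolyhedron C r)).Nonempty :=
    (hC.cell_inter_frontier_nonempty_iff hr hvert hS (hTS hs) hcell).2
      (convexHull_subset_frontier_of_cellHull_inter hC.finite hr hvert hS (hTS hs) hne)
  -- The cell is not a Voronoi vertex, since those are interior.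
  obtain ⟨m, hm⟩ : ∃ m, setDim (cell C S) = m + 1 := by
    refine Nat.exists_eq_add_one_of_ne_zero fun h0 => ?_
    obtain ⟨x, hx, hxf⟩ := hface
    exact hxf.2 (hvert _ ⟨cell_mem_voronoiDiagram_iff.2 hcell, h0⟩ hx)
  exact ⟨m, (hball S hS m hm hface).2⟩

lemma eventually_faces :
    ∀ᶠ r : ℝ in atTop, ∀ (m : ℕ) (F : Set (E d)),
      (IsFace C r m F → IsOpenTopBall m F) ∧ (IsClosedFace C r m F → IsClosedTopBall m F) := by
  filter_upwards [hC.eventually_forall_topBall] with r hball m F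
  constructor
  · rintro ⟨V, ⟨hV, hm⟩, hne, rfl⟩
    obtain ⟨S, hS, -, rfl⟩ := mem_voronoiDiagram_iff.1 hV
    exact (hball S hS m hm hne).1
  · rintro ⟨V, ⟨hV, hm⟩, hne, rfl⟩
    obtain ⟨S, hS, hcell, rfl⟩ := mem_voronoiDiagram_iff.1 hV
    obtain ⟨s, hs⟩ := nonempty_of_cell_nonempty hC.finite hC.nonempty hcell
    rw [closure_cell hS hs hcell]
    exact (hball S hS m hm hne).2

end IsPolytopeVertexSet

end StandardBallPolyhedra

end BallPoly

theorem theorem3 (d : ℕ) (hd : 2 ≤ d) (C : Set (BallPoly.E d))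
    (hC : BallPoly.IsPolytopeVertexSet C) :
    -- (i)
    (∀ S : Set (BallPoly.E d), S ⊆ C → ∀ k : ℕ, k ≤ d →
      (BallPoly.IsVoronoiFace C k (BallPoly.cell C S) ↔
        convexHull ℝ S ∈ BallPoly.delaunayComplex C ∧
          BallPoly.setDim (convexHull ℝ S) = d - k)) ∧
    -- (ii)
    (∀ r : ℝ, BallPoly.IsBasic C r →
      ∀ S : Set (BallPoly.E d), S ⊆ C → ∀ k : ℕ, 1 ≤ k → k ≤ d →
        (BallPoly.IsFace C r (k - 1)
            (BallPoly.cell C S ∩ frontier (BallPoly.ballPolyhedron C r)) ↔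
          convexHull ℝ S ∈ BallPoly.boundaryDelaunayComplex C ∧
            BallPoly.setDim (convexHull ℝ S) = d - k)) ∧
    -- (iii)
    (∃ r₀ : ℝ, 0 < r₀ ∧ ∀ r : ℝ, r₀ ≤ r →
      BallPoly.IsBasic C r ∧ BallPoly.IsStandard C r ∧
      ∀ k : ℕ, 1 ≤ k → k ≤ d → ∀ F : Set (BallPoly.E d),
        (BallPoly.IsFace C r (k - 1) F → BallPoly.IsOpenTopBall (k - 1) F) ∧
        (BallPoly.IsClosedFace C r (k - 1) F → BallPoly.IsClosedTopBall (k - 1) F)) := by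

  have hd0 : d ≠ 0 := by omega
  refine ⟨fun S hS k hk => hC.isVoronoiFace_iff hS hk,
    fun r hr S hS k hk1 hk => hC.isFace_iff hr hS hk1 hk, ?_⟩
  obtain ⟨r₁, h₁⟩ := Filter.eventually_atTop.1 ((hC.eventually_isBasic hd0).and
    ((hC.eventually_isStandard hd0).and hC.eventually_faces))
  refine ⟨max r₁ 1, by positivity, fun r hr => ?_⟩
  obtain ⟨hbasic, hstd, hfaces⟩ := h₁ r (le_of_max_le_left hr)
  exact ⟨hbasic, hstd, fun k _ _ F => hfaces (k - 1) F⟩
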